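/- All graphs are finite. A graph $G$ is \emph{$q$-cut-dense} if for every partition $V(G)=A\cup B$ there are at least $q|A||B|$ edges between $A$ and $B$. A \emph{perfect $k$-ary tree of height $h$} is a tree with a designated root in which every non-leaf vertex has degree $k$ and every leaf is at distance $h$ from the root. A graph $G$ \emph{has a copy} of $T$ if there is an injective graph homomorphism $T\to G$. There are functions $f,g:(0,\infty)\to(0,\infty)$ such that the following holds for all real $p,q,\varepsilon>0$ and all positive integers $\Delta,L,d$ with $$L^{-1}\le \min\{f(p),f(q),f(\varepsilon),f(\Delta^{-1})\}\qquad\text{and}\qquad d^{-1}\le g(L^{-1})$$ (that is, for $p,q,\varepsilon,\Delta^{-1}\gg L^{-1}\gg d^{-1}$). Let $T$ be a tree with $d$ vertices and maximum degree at most $\Delta$, and let $G$ be a graph which has one of the following structures: (i) $G$ is a $q$-cut-dense graph on $n$ vertices that contains a $pn$-regular subgraph $R$ with at least $(2+\varepsilon)d$ vertices. (ii) There are subgraphs $G_1,\dots,G_t$ of $G$ with $E(G)=E(G_1)\cup\dots\cup E(G_t)$, each of which is $q$-cut-dense and has at least $\frac{16d}{qL}$ vertices. There are a perfect $L$-ary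 tree $S$ of height $L$ with $V(S)=\{G_1,\dots,G_t\}$ and distinct vertices $u_{G_iG_j}\in V(G)$, one for each edge $G_iG_j\in E(S)$, such that $V(G_i)\cap V(G_j)=\{u_{G_iG_j}\}$ whenever $G_iG_j\in E(S)$, and $V(G_i)\cap V(G_j)=\emptyset$ whenever $i\neq j$ and $G_iG_j\notin E(S)$. Then $G$ has a copy of $T$. -/

import Mathlib

namespace SimpleGraph

open Classical in
/-- A finite graph is `q`-cut-dense if every partition of its vertex set into `A` and `B` has at
least `q |A| |B|` edges between `A` and `B`. (For disjoint `A`, `B`, the finset `interedges A B`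
holds every edge between `A` and `B` exactly once, as the pair with its first entry in `A`.) -/
def IsCutDense {V : Type*} [Fintype V] (G : SimpleGraph V) (q : ℝ) : Prop :=
  ∀ A B : Finset V, Disjoint A B → A ∪ B = Finset.univ →
    q * (A.card : ℝ) * (B.card : ℝ) ≤ ((G.interedges A B).card : ℝ)

open Classical in
/-- `S` is a perfect `k`-ary tree of height `h` with root `r`: every vertex that is not a leaf has
degree `k`, and every leaf is at distance `h` from `r`. -/
def IsPerfectAryTree {ι : Type*} [Fintype ι] (S : SimpleGraph ι) (r : ι) (k h : ℕ) : Prop :=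
  S.IsTree ∧ (∀ v, S.degree v ≠ 1 → S.degree v = k) ∧ ∀ v, S.degree v = 1 → S.dist r v = h

open Classical in
/-- `G` is an `n`-vertex `q`-cut-dense graph that contains a (not necessarily induced)
`p n`-regular subgraph on at least `m` vertices. -/
def IsCutDenseWithRegularSubgraph {V : Type*} [Fintype V] (G : SimpleGraph V) (p q m : ℝ) : Prop :=
  G.IsCutDense q ∧ ∃ R : G.Subgraph,
    (∀ v ∈ R.verts, (R.degree v : ℝ) = p * (Fintype.card V : ℝ)) ∧ m ≤ (R.verts.ncard : ℝ)

open Classical in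
/-- The edge set of `G` is the union of the edge sets of `q`-cut-dense subgraphs
`P 0, …, P (t - 1)`, each on at least `m` vertices, which are the vertices of a perfect `L`-ary
tree `S` of height `L`. There are distinct vertices `u e` of `G`, one for every edge `e` of `S`,
such that pieces adjacent in `S` share exactly the vertex of their edge, and distinct pieces not
adjacent in `S` are disjoint. -/
def IsAryTreeOfCutDense {V : Type*} [Fintype V] (G : SimpleGraph V) (q : ℝ) (L : ℕ) (m : ℝ) :
    Prop :=
  ∃ (t : ℕ) (P : Fin t → G.Subgraph) (S : SimpleGraph (Fin t)) (r : Fin t) (u : Sym2 (Fin t) → V),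
    G.edgeSet = ⋃ i, (P i).edgeSet ∧
    (∀ i, m ≤ ((P i).verts.ncard : ℝ) ∧ (P i).coe.IsCutDense q) ∧
    S.IsPerfectAryTree r L L ∧
    Set.InjOn u S.edgeSet ∧
    (∀ i j, S.Adj i j → (P i).verts ∩ (P j).verts = {u s(i, j)}) ∧
    (∀ i j, i ≠ j → ¬ S.Adj i j → (P i).verts ∩ (P j).verts = ∅)

end SimpleGraph

/-! Both structures rest on a reservoir: in a large cut-dense graph a small set `R` suffices to lead
from any vertex `x` to any target set `Y` of a fixed size `N`, in boundedly many steps and with many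
choices in `R` at every intermediate step. `CutDenseOn.exists_mem_level` shows why `Y` is reachable.
The vertices with many neighbours in `Y` already form a positive proportion of the graph, and
crossing edges enlarge the set of vertices that can reach `Y` by a fixed proportion per step until
it is nearly everything. `exists_reservoir` thins this out: for fixed `N` there are only
polynomially many neighbourhoods to hit, each of linear size, so a small linear-size set hits all of
them many times.

The tree `T` is rooted and embedded downwards. `ParentTree.exists_top` cuts from a subtree a top of
at most `τ` vertices such that each subtree strictly below its cut vertex is smaller by at least
`τ`. Tops are placed greedily where degrees are large. Below the cut vertex, a bounded number of
levels (`IsPartialEmb.descend`) runs through the reservoir to a chosen set `Y`, where new subtrees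
start. As sizes drop by `τ` each round, the number of rounds is bounded.

For structure (i), a regular graph with more than `2d` vertices keeps a positive proportion of its
edges after the loss of `d` vertices and the reservoir, since a vertex meets at most a `2/|R|`
proportion of the edges of the regular graph `R`. Hence a subset of minimum degree linear in `d` is
always available for the next tops, and `Y` is taken inside it (`IsPartialEmb.extend_pdesc`). If `d`
is below the degree of `R`, greedy embedding is enough. Since `τ` is a constant fraction of `d`, the
total use of the reservoir is a constant.

For structure (ii), `Y` consists of vertices shared by a piece with its children, and each new
subtree moves into the branch of its own child (`IsPartialEmb.extend_pdesc_branch`). Distinct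
branches are disjoint, so the continuations do not interfere. Each of the `L + 1` levels of pieces
removes about `d / L` from the size of the subtree, so the tree is used up by the last level. -/

section
open Classical

/-! ### Rooted trees, subtrees and their tops -/

/-- A rooted tree given by its parent function. -/
structure ParentTree (W : Type*) where
  root : W
  par : W → W
  depth : W → ℕ
  par_root : par root = root
  depth_root : depth root = 0
  depth_par : ∀ v, v ≠ root → depth (par v) + 1 = depth v

namespace ParentTree

variable {W : Type*} (D : ParentTree W)

/-- `v` is a descendant of `c`. -/
def IsDesc (c v : W) : Prop := ∃ k, D.par^[k] v = c

lemma IsDesc.refl (c : W) : D.IsDesc c c := ⟨0, rfl⟩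

variable {D}

lemma IsDesc.trans {a b c : W} (h : D.IsDesc a b) (h' : D.IsDesc b c) : D.IsDesc a c := by
  obtain ⟨k, rfl⟩ := h
  obtain ⟨l, rfl⟩ := h'
  exact ⟨k + l, Function.iterate_add_apply _ _ _ _⟩

lemma isDesc_par (v : W) : D.IsDesc (D.par v) v := ⟨1, rfl⟩

lemma depth_par_eq (v : W) : D.depth (D.par v) = D.depth v - 1 := by
  by_cases h : v = D.root
  · subst h; rw [D.par_root, D.depth_root]
  · have := D.depth_par v h; omega

lemma depth_iterate (k : ℕ) (v : W) : D.depth (D.par^[k] v) = D.depth v - k := by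
  induction k with
  | zero => rfl
  | succ k ih => rw [Function.iterate_succ_apply', depth_par_eq, ih]; omega

lemma eq_root_of_depth {v : W} (h : D.depth v = 0) : v = D.root := by
  by_contra hv
  have := D.depth_par v hv
  omega

lemma isDesc_root (v : W) : D.IsDesc D.root v :=
  ⟨D.depth v, eq_root_of_depth (by rw [depth_iterate]; omega)⟩

lemma IsDesc.depth_le {c v : W} (h : D.IsDesc c v) : D.depth c ≤ D.depth v := by
  obtain ⟨k, rfl⟩ := h
  rw [depth_iterate]; omega

lemma IsDesc.par_of_ne {c v : W} (h : D.IsDesc c v) (hne : v ≠ c) :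
    v ≠ D.root ∧ D.IsDesc c (D.par v) := by
  obtain ⟨k, hk⟩ := h
  cases k with
  | zero => exact absurd hk hne
  | succ k =>
    refine ⟨?_, k, by rwa [Function.iterate_succ_apply] at hk⟩
    rintro rfl
    exact hne (by rw [← hk, Function.iterate_fixed D.par_root])

lemma IsDesc.depth_lt {c v : W} (h : D.IsDesc c v) (hne : v ≠ c) : D.depth c < D.depth v := by
  obtain ⟨h1, h2⟩ := h.par_of_ne hne
  have := h2.depth_le
  have := D.depth_par v h1
  omega

lemma IsDesc.eq_of_depth_le {c v : W} (h : D.IsDesc c v) (hd : D.depth v ≤ D.depth c) : v = c := by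
  by_contra hne
  have := h.depth_lt hne
  omega

/-- The ancestors of `v` are iterates of one map at `v`, so they form a chain ordered by depth. -/
lemma IsDesc.isDesc_of_depth_le {a b v : W} (ha : D.IsDesc a v) (hb : D.IsDesc b v)
    (h : D.depth a ≤ D.depth b) : D.IsDesc a b := by
  obtain ⟨k, rfl⟩ := ha
  obtain ⟨l, rfl⟩ := hb
  rcases le_total l k with hlk | hlk
  · exact ⟨k - l, by rw [← Function.iterate_add_apply]; congr 2; omega⟩
  · have h1 : D.IsDesc (D.par^[l] v) (D.par^[k] v) :=
      ⟨l - k, by rw [← Function.iterate_add_apply]; congr 2; omega⟩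
    rw [h1.eq_of_depth_le h]
    exact IsDesc.refl D _

lemma IsDesc.eq_of_depth_eq {a b v : W} (ha : D.IsDesc a v) (hb : D.IsDesc b v)
    (h : D.depth a = D.depth b) : a = b :=
  ((ha.isDesc_of_depth_le hb h.le).eq_of_depth_le h.ge).symm

lemma IsDesc.exists_depth_eq {c v : W} (h : D.IsDesc c v) {j : ℕ}
    (hj : D.depth c + j ≤ D.depth v) :
    ∃ x, D.IsDesc c x ∧ D.IsDesc x v ∧ D.depth x = D.depth c + j := by
  refine ⟨D.par^[D.depth v - (D.depth c + j)] v, ?_, ⟨_, rfl⟩, by rw [depth_iterate]; omega⟩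
  refine h.isDesc_of_depth_le ⟨_, rfl⟩ ?_
  rw [depth_iterate]; omega

variable (D) [Fintype W]

/-- The descendants of `c`. -/
noncomputable def desc (c : W) : Finset W := {v | D.IsDesc c v}

/-- The proper descendants of `c`. -/
noncomputable def pdesc (c : W) : Finset W := (D.desc c).erase c

/-- The descendants of `c` that are `j` levels below `c`. -/
noncomputable def descAt (c : W) (j : ℕ) : Finset W :=
  {v ∈ D.desc c | D.depth v = D.depth c + j}

/-- The children of `c`. -/
noncomputable def children (c : W) : Finset W := {v | v ≠ D.root ∧ D.par v = c}

variable {D}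

@[simp] lemma mem_desc {c v : W} : v ∈ D.desc c ↔ D.IsDesc c v := by simp [desc]

lemma mem_pdesc {c v : W} : v ∈ D.pdesc c ↔ v ≠ c ∧ D.IsDesc c v := by simp [pdesc]

lemma mem_descAt {c v : W} {j : ℕ} :
    v ∈ D.descAt c j ↔ D.IsDesc c v ∧ D.depth v = D.depth c + j := by simp [descAt]

lemma mem_children {c v : W} : v ∈ D.children c ↔ v ≠ D.root ∧ D.par v = c := by simp [children]

lemma self_mem_desc (c : W) : c ∈ D.desc c := mem_desc.2 (IsDesc.refl D c)

lemma desc_subset {c v : W} (h : D.IsDesc c v) : D.desc v ⊆ D.desc c :=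
  fun _ hx => mem_desc.2 (h.trans (mem_desc.1 hx))

lemma desc_root : D.desc D.root = Finset.univ := by
  ext v; simp [isDesc_root]

lemma card_descAt_le {Δ : ℕ} (hΔ : ∀ v, (D.children v).card ≤ Δ) (c : W) (j : ℕ) :
    (D.descAt c j).card ≤ Δ ^ j := by
  induction j with
  | zero =>
    rw [pow_zero]
    refine (Finset.card_le_card (t := {c}) fun v hv => ?_).trans (by simp)
    obtain ⟨h1, h2⟩ := mem_descAt.1 hv
    exact Finset.mem_singleton.2 (h1.eq_of_depth_le h2.le)
  | succ j ih =>
    have hsub : D.descAt c (j + 1) ⊆ (D.descAt c j).biUnion D.children := by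
      intro v hv
      obtain ⟨h1, h2⟩ := mem_descAt.1 hv
      have hne : v ≠ c := by rintro rfl; omega
      obtain ⟨h3, h4⟩ := h1.par_of_ne hne
      refine Finset.mem_biUnion.2 ⟨D.par v, mem_descAt.2 ⟨h4, ?_⟩, mem_children.2 ⟨h3, rfl⟩⟩
      have := D.depth_par v h3
      omega
    calc (D.descAt c (j + 1)).card ≤ _ := Finset.card_le_card hsub
      _ ≤ (D.descAt c j).card * Δ := Finset.card_biUnion_le_card_mul _ _ _ fun v _ => hΔ v
      _ ≤ Δ ^ j * Δ := Nat.mul_le_mul_right _ ih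
      _ = Δ ^ (j + 1) := (pow_succ _ _).symm

/-- Cut off the part of the subtree at `w` that lies strictly below a deepest vertex `v` whose
subtree misses fewer than `τ` vertices of the subtree at `w`. -/
lemma exists_top (w : W) {τ : ℕ} (hτ : 1 ≤ τ) :
    ∃ v, D.IsDesc w v ∧ (D.desc w \ D.pdesc v).card ≤ τ ∧
      ∀ x ∈ D.pdesc v, (D.desc x).card + τ ≤ (D.desc w).card := by
  have hne : ({v ∈ D.desc w | (D.desc w).card < (D.desc v).card + τ} : Finset W).Nonempty :=
    ⟨w, by simp only [Finset.mem_filter]; exact ⟨self_mem_desc w, by omega⟩⟩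
  obtain ⟨v, hv, hmax⟩ := Finset.exists_max_image _ D.depth hne
  rw [Finset.mem_filter, mem_desc] at hv
  refine ⟨v, hv.1, ?_, fun x hx => ?_⟩
  · have h1 : D.pdesc v ⊆ D.desc w := (Finset.erase_subset _ _).trans (desc_subset hv.1)
    rw [Finset.card_sdiff_of_subset h1, pdesc, Finset.card_erase_of_mem (self_mem_desc v)]
    have := Finset.card_le_card (desc_subset hv.1)
    have : 0 < (D.desc v).card := Finset.card_pos.2 ⟨v, self_mem_desc v⟩
    omega
  -- A proper descendant violating the bound would itself lie in the filtered set, at greater depth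
  -- than the deepest element `v`.
  · by_contra hlt
    obtain ⟨h1, h2⟩ := mem_pdesc.1 hx
    have := hmax x (by rw [Finset.mem_filter, mem_desc]; exact ⟨hv.1.trans h2, by omega⟩)
    have := h2.depth_lt h1
    omega

end ParentTree

lemma SimpleGraph.IsTree.exists_parentTree {W : Type*} {T : SimpleGraph W} (hT : T.IsTree)
    (r : W) : ∃ D : ParentTree W, D.root = r ∧ (∀ v, D.depth v = T.dist r v) ∧
      (∀ v, v ≠ D.root → T.Adj (D.par v) v) ∧
      ∀ x y, T.Adj x y → (x ≠ D.root ∧ D.par x = y) ∨ (y ≠ D.root ∧ D.par y = x) := by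
  have hpar : ∀ v, v ≠ r → ∃ u, T.Adj u v ∧ T.dist r u + 1 = T.dist r v := by
    intro v hv
    obtain ⟨p, hp, hlen⟩ := hT.1.exists_path_of_dist r v
    have hnil : ¬ p.Nil := fun h => hv h.eq.symm
    refine ⟨p.penultimate, p.adj_penultimate hnil, ?_⟩
    have h1 : T.dist r p.penultimate ≤ p.dropLast.length := SimpleGraph.dist_le _
    have h2 : p.dropLast.length + 1 = p.length := by simpa using p.length_dropLast_add_one hnil
    have h3 := (p.adj_penultimate hnil).diff_dist_adj (u := r)
    omega
  choose! par hadj hdist using hpar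
  -- Two neighbours of `v` closer to the root would extend to two shortest paths from `r` to `v`;
  -- paths in a tree are unique, so their penultimate vertices agree.
  have huniq : ∀ v u, T.Adj u v → T.dist r u + 1 = T.dist r v → par v = u := by
    intro v u huv hd
    have hv : v ≠ r := by rintro rfl; simp at hd
    obtain ⟨p, hp, hlp⟩ := hT.1.exists_path_of_dist r u
    obtain ⟨p', hp', hlp'⟩ := hT.1.exists_path_of_dist r (par v)
    have a1 : (p.concat huv).IsPath := by
      apply SimpleGraph.Walk.isPath_of_length_eq_dist; simp [hlp, hd]
    have a2 : (p'.concat (hadj v hv)).IsPath := by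
      apply SimpleGraph.Walk.isPath_of_length_eq_dist; simp [hlp', hdist v hv]
    have h := (hT.existsUnique_path r v).unique a1 a2
    have := congrArg SimpleGraph.Walk.penultimate h
    simpa using this.symm
  refine ⟨⟨r, fun v => if v = r then r else par v, T.dist r, by simp, by simp, fun v hv => ?_⟩,
    rfl, fun _ => rfl, fun v hv => ?_, fun x y hxy => ?_⟩
  · simp only [if_neg hv]; exact hdist v hv
  · simp only at hv ⊢; rw [if_neg hv]; exact hadj v hv
  · simp only
    rcases hT.dist_eq_dist_add_one_of_adj r hxy with h | h
    · left
      have : x ≠ r := by rintro rfl; simp at h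
      exact ⟨this, by rw [if_neg this]; exact huniq _ _ hxy.symm h.symm⟩
    · right
      have : y ≠ r := by rintro rfl; simp at h
      exact ⟨this, by rw [if_neg this]; exact huniq _ _ hxy h.symm⟩

namespace ParentTree

variable {W : Type*} [Fintype W] {D : ParentTree W}

variable (D) in
/-- The proper descendants of `c` that are at most `m` levels below `c`. -/
noncomputable def near (c : W) (m : ℕ) : Finset W :=
  {v ∈ D.pdesc c | D.depth v ≤ D.depth c + m}

lemma mem_near {c v : W} {m : ℕ} :
    v ∈ D.near c m ↔ (v ≠ c ∧ D.IsDesc c v) ∧ D.depth v ≤ D.depth c + m := by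
  simp [near, mem_pdesc]

lemma card_near_le {Δ : ℕ} (hΔ0 : 1 ≤ Δ) (hΔ : ∀ v, (D.children v).card ≤ Δ) (c : W) (m : ℕ) :
    (D.near c m).card ≤ m * Δ ^ m := by
  have hsub : D.near c m ⊆ (Finset.Icc 1 m).biUnion (D.descAt c) := by
    intro v hv
    obtain ⟨⟨h1, h2⟩, h3⟩ := mem_near.1 hv
    have := h2.depth_lt h1
    exact Finset.mem_biUnion.2 ⟨D.depth v - D.depth c, Finset.mem_Icc.2 ⟨by omega, by omega⟩,
      mem_descAt.2 ⟨h2, by omega⟩⟩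
  calc (D.near c m).card ≤ _ := Finset.card_le_card hsub
    _ ≤ (Finset.Icc 1 m).card * Δ ^ m := by
      refine Finset.card_biUnion_le_card_mul _ _ _ fun j hj => ?_
      exact (card_descAt_le hΔ c j).trans (Nat.pow_le_pow_right hΔ0 (Finset.mem_Icc.1 hj).2)
    _ = m * Δ ^ m := by simp

lemma desc_disjoint {a b : W} (hab : ¬ D.IsDesc a b) (hba : ¬ D.IsDesc b a) :
    Disjoint (D.desc a) (D.desc b) := by
  rw [Finset.disjoint_left]
  intro x hxa hxb
  rw [mem_desc] at hxa hxb
  rcases le_total (D.depth a) (D.depth b) with h | h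
  · exact hab (hxa.isDesc_of_depth_le hxb h)
  · exact hba (hxb.isDesc_of_depth_le hxa h)

lemma desc_disjoint_of_depth_eq {a b : W} (hab : a ≠ b) (h : D.depth a = D.depth b) :
    Disjoint (D.desc a) (D.desc b) :=
  desc_disjoint (fun h' => hab (h'.eq_of_depth_le h.ge).symm)
    (fun h' => hab (h'.eq_of_depth_le h.le))

lemma pdesc_subset_desc (c : W) : D.pdesc c ⊆ D.desc c := Finset.erase_subset _ _

/-- Separates what one descent embeds from the subtrees that still hang from its last level. -/
lemma pdesc_eq_near_union (c : W) (m : ℕ) :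
    D.pdesc c = D.near c m ∪ (D.descAt c m).biUnion D.pdesc := by
  ext v
  simp only [Finset.mem_union, mem_near, Finset.mem_biUnion, mem_pdesc, mem_descAt]
  constructor
  · rintro ⟨h1, h2⟩
    by_cases h : D.depth v ≤ D.depth c + m
    · exact Or.inl ⟨⟨h1, h2⟩, h⟩
    · obtain ⟨x, h3, h4, h5⟩ := h2.exists_depth_eq (j := m) (by omega)
      exact Or.inr ⟨x, ⟨h3, h5⟩, by rintro rfl; omega, h4⟩
  · rintro (⟨h, -⟩ | ⟨x, ⟨h3, h5⟩, h6, h7⟩)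
    · exact h
    · refine ⟨?_, h3.trans h7⟩
      rintro rfl
      exact h6 (h7.eq_of_depth_le h3.depth_le)

end ParentTree

/-! ### Neighbour counts and greedy extension of partial embeddings -/

namespace SimpleGraph

variable {V : Type*} (G : SimpleGraph V)

/-- The neighbours of `x` in the finite set `B`. -/
noncomputable def nbrIn (x : V) (B : Finset V) : Finset V := {y ∈ B | G.Adj x y}

variable {G}

lemma mem_nbrIn {x y : V} {B : Finset V} : y ∈ G.nbrIn x B ↔ y ∈ B ∧ G.Adj x y := by
  simp [nbrIn]

lemma nbrIn_subset (x : V) (B : Finset V) : G.nbrIn x B ⊆ B := Finset.filter_subset _ _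

lemma nbrIn_mono (x : V) {B B' : Finset V} (h : B ⊆ B') : G.nbrIn x B ⊆ G.nbrIn x B' :=
  Finset.filter_subset_filter _ h

lemma nbrIn_sdiff (x : V) (B F : Finset V) : G.nbrIn x (B \ F) = G.nbrIn x B \ F := by
  ext y; simp only [mem_nbrIn, Finset.mem_sdiff]; tauto

lemma card_nbrIn_le_sdiff_add (x : V) (B F : Finset V) :
    (G.nbrIn x B).card ≤ (G.nbrIn x (B \ F)).card + (B ∩ F).card := by
  rw [nbrIn_sdiff]
  have h : G.nbrIn x B ⊆ (G.nbrIn x B \ F) ∪ (B ∩ F) := by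
    intro y hy
    by_cases hF : y ∈ F
    · exact Finset.mem_union_right _ (Finset.mem_inter.2 ⟨nbrIn_subset _ _ hy, hF⟩)
    · exact Finset.mem_union_left _ (Finset.mem_sdiff.2 ⟨hy, hF⟩)
  exact (Finset.card_le_card h).trans (Finset.card_union_le _ _)

end SimpleGraph

open SimpleGraph

variable {W V : Type*}

/-- `φ` embeds the parent-closed set `A` of vertices of the rooted tree `D` in `G`. -/
structure IsPartialEmb (D : ParentTree W) (G : SimpleGraph V) (A : Finset W) (φ : W → V) :
    Prop where
  par_mem : ∀ v ∈ A, v ≠ D.root → D.par v ∈ A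
  inj : Set.InjOn φ A
  adj : ∀ v ∈ A, v ≠ D.root → G.Adj (φ (D.par v)) (φ v)

namespace IsPartialEmb

variable {D : ParentTree W} {G : SimpleGraph V} {A : Finset W} {φ : W → V}

lemma singleton_root (x : V) : IsPartialEmb D G {D.root} fun _ => x :=
  ⟨fun v hv hne => absurd (Finset.mem_singleton.1 hv) hne, by simp,
    fun v hv hne => absurd (Finset.mem_singleton.1 hv) hne⟩

/-- Greedy extension of a partial embedding, where `v` must be placed in `B v`. -/
lemma extend (h : IsPartialEmb D G A φ) (B : W → Finset V) (N : Finset W) (hNA : Disjoint N A)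
    (hpar : ∀ v ∈ N, v ≠ D.root ∧ (D.par v ∈ A ∨ D.par v ∈ N))
    (hA : ∀ v ∈ N, D.par v ∈ A → N.card ≤ (G.nbrIn (φ (D.par v)) (B v \ A.image φ)).card)
    (hN : ∀ v ∈ N, D.par v ∈ N → ∀ x ∈ B (D.par v),
      N.card ≤ (G.nbrIn x (B v \ A.image φ)).card) :
    ∃ φ' : W → V, (∀ v ∈ A, φ' v = φ v) ∧ IsPartialEmb D G (A ∪ N) φ' ∧ ∀ v ∈ N, φ' v ∈ B v := by
  -- The deepest vertex `a` is placed last: no vertex of `s` has it as parent, and the `s.card`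
  -- images chosen before it cannot exhaust its more than `s.card` candidates.
  induction N using Finset.induction_on_max_value D.depth with
  | empty => exact ⟨φ, fun _ _ => rfl, by simpa using h, by simp⟩
  | insert a s has hmax ih =>
    have hcard : (insert a s).card = s.card + 1 := Finset.card_insert_of_notMem has
    obtain ⟨ha0, haPar⟩ := hpar a (Finset.mem_insert_self _ _)
    have hpara : D.par a ≠ a := by
      intro hh; have := D.depth_par a ha0; rw [hh] at this; omega
    have hnot : ∀ v ∈ s, D.par v ≠ a := by
      intro v hv hh
      have h1 := D.depth_par v (hpar v (Finset.mem_insert_of_mem hv)).1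
      have h2 := hmax v hv
      rw [hh] at h1; omega
    have haA : a ∉ A := Finset.disjoint_left.1 hNA (Finset.mem_insert_self _ _)
    obtain ⟨φ₁, hφ₁, hP, hB⟩ := ih (hNA.mono_left (Finset.subset_insert _ _))
      (fun v hv => by
        obtain ⟨h1, h2⟩ := hpar v (Finset.mem_insert_of_mem hv)
        refine ⟨h1, h2.imp id fun h3 => (Finset.mem_insert.1 h3).resolve_left (hnot v hv)⟩)
      (fun v hv hv' => by
        have := hA v (Finset.mem_insert_of_mem hv) hv'; omega)
      (fun v hv hv' x hx => by
        have := hN v (Finset.mem_insert_of_mem hv) (Finset.mem_insert_of_mem hv') x hx; omega)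
    have haAs : a ∉ A ∪ s := by simp [haA, has]
    have hparAs : D.par a ∈ A ∪ s := by
      rcases haPar with h1 | h1
      · exact Finset.mem_union_left _ h1
      · exact Finset.mem_union_right _ ((Finset.mem_insert.1 h1).resolve_left hpara)
    have hcnt : s.card < (G.nbrIn (φ₁ (D.par a)) (B a \ A.image φ)).card := by
      rcases haPar with h1 | h1
      · have := hA a (Finset.mem_insert_self _ _) h1
        rw [hφ₁ _ h1]; omega
      · have h2 := (Finset.mem_insert.1 h1).resolve_left hpara
        have := hN a (Finset.mem_insert_self _ _) h1 _ (hB _ h2)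
        omega
    obtain ⟨y, hy, hys⟩ := Finset.exists_mem_notMem_of_card_lt_card
      ((Finset.card_image_le (s := s) (f := φ₁)).trans_lt hcnt)
    rw [mem_nbrIn, Finset.mem_sdiff] at hy
    obtain ⟨⟨hyB, hyA⟩, hyadj⟩ := hy
    have hyAs : y ∉ (A ∪ s).image φ₁ := by
      rw [Finset.image_union, Finset.mem_union, not_or]
      refine ⟨?_, hys⟩
      rwa [Finset.image_congr (fun v hv => hφ₁ v hv)]
    have hupd : ∀ v ∈ A ∪ s, Function.update φ₁ a y v = φ₁ v := fun v hv =>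
      Function.update_of_ne (by rintro rfl; exact haAs hv) _ _
    have hun : A ∪ insert a s = insert a (A ∪ s) := Finset.union_insert _ _ _
    refine ⟨Function.update φ₁ a y, fun v hv => ?_, ⟨?_, ?_, ?_⟩, ?_⟩
    · rw [hupd v (Finset.mem_union_left _ hv), hφ₁ v hv]
    · rw [hun]
      intro v hv hv0
      rcases Finset.mem_insert.1 hv with rfl | hv
      · exact Finset.mem_insert_of_mem hparAs
      · exact Finset.mem_insert_of_mem (hP.par_mem v hv hv0)
    · rw [hun, Finset.coe_insert, Set.injOn_insert (by simpa using haAs)]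
      refine ⟨hP.inj.congr fun v hv => (hupd v hv).symm, ?_⟩
      rw [Function.update_self]
      rintro ⟨v, hv, hvy⟩
      rw [hupd v hv] at hvy
      exact hyAs (Finset.mem_image.2 ⟨v, hv, hvy⟩)
    · rw [hun]
      intro v hv hv0
      rcases Finset.mem_insert.1 hv with rfl | hv
      · rw [Function.update_self, hupd _ hparAs]; exact hyadj
      · rw [hupd v hv, hupd _ (hP.par_mem v hv hv0)]; exact hP.adj v hv hv0
    · intro v hv
      rcases Finset.mem_insert.1 hv with rfl | hv
      · rwa [Function.update_self]
      · rw [hupd v (Finset.mem_union_right _ hv)]; exact hB v hv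

variable [Fintype W]

/-- Embed the first `ℓ + 1` levels below `c`: the first `ℓ` of them in `S`, along the level sets
`Z ℓ, …, Z 0`, and the last one in `Y`. -/
lemma descend (h : IsPartialEmb D G A φ) {c : W} (hc : c ∈ A) (hcA : Disjoint (D.pdesc c) A)
    {Δ : ℕ} (hΔ0 : 1 ≤ Δ) (hΔ : ∀ v, (D.children v).card ≤ Δ) {ℓ C : ℕ} (hℓ : ℓ ≤ C)
    (S Y : Finset V) (Z : ℕ → Finset V) (hx : φ c ∈ Z ℓ)
    (hY : ∀ v ∈ Z 0, (C + 1) * Δ ^ (C + 1) ≤ (G.nbrIn v (Y \ A.image φ)).card)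
    (hZ : ∀ i < ℓ, ∀ v ∈ Z (i + 1),
      (C + 1) * Δ ^ (C + 1) ≤ (G.nbrIn v ((Z i ∩ S) \ A.image φ)).card) :
    ∃ φ' : W → V, (∀ v ∈ A, φ' v = φ v) ∧ IsPartialEmb D G (A ∪ D.near c (ℓ + 1)) φ' ∧
      (∀ v ∈ D.near c ℓ, φ' v ∈ S) ∧ ∀ v ∈ D.descAt c (ℓ + 1), φ' v ∈ Y := by
  -- A vertex `i` levels below `c` goes to `Z (ℓ - i)`, so level `ℓ` lands in `Z 0`, whose vertices
  -- see many vertices of `Y`, and level `ℓ + 1` lands in `Y`.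
  set B : W → Finset V := fun v =>
    if D.depth v = D.depth c + (ℓ + 1) then Y else Z (D.depth c + ℓ - D.depth v) ∩ S with hBdef
  have hcard : (D.near c (ℓ + 1)).card ≤ (C + 1) * Δ ^ (C + 1) :=
    (ParentTree.card_near_le hΔ0 hΔ c (ℓ + 1)).trans
      (Nat.mul_le_mul (by omega) (Nat.pow_le_pow_right hΔ0 (by omega)))
  have key : ∀ v ∈ D.near c (ℓ + 1), ∀ x, x ∈ Z (D.depth c + ℓ - D.depth (D.par v)) →
      (D.near c (ℓ + 1)).card ≤ (G.nbrIn x (B v \ A.image φ)).card := by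
    intro v hv x hx
    obtain ⟨⟨h1, h2⟩, h3⟩ := ParentTree.mem_near.1 hv
    have h4 := D.depth_par v (h2.par_of_ne h1).1
    have h5 := h2.depth_lt h1
    refine hcard.trans ?_
    simp only [hBdef]
    split_ifs with hd
    · exact hY x (by rwa [show D.depth c + ℓ - D.depth (D.par v) = 0 by omega] at hx)
    · refine hZ _ (by omega) x ?_
      rwa [show D.depth c + ℓ - D.depth v + 1 = D.depth c + ℓ - D.depth (D.par v) by omega]
  obtain ⟨φ', h1, h2, h3⟩ := h.extend B (D.near c (ℓ + 1))
    (hcA.mono_left (Finset.filter_subset _ _))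
    (fun v hv => by
      obtain ⟨⟨h1, h2⟩, h3⟩ := ParentTree.mem_near.1 hv
      obtain ⟨h4, h5⟩ := h2.par_of_ne h1
      refine ⟨h4, ?_⟩
      by_cases hh : D.par v = c
      · left; rwa [hh]
      · right
        have := D.depth_par v h4
        exact ParentTree.mem_near.2 ⟨⟨hh, h5⟩, by omega⟩)
    (fun v hv hv' => by
      obtain ⟨⟨h1, h2⟩, h3⟩ := ParentTree.mem_near.1 hv
      obtain ⟨h4, h5⟩ := h2.par_of_ne h1
      have hh : D.par v = c := by
        by_contra hh
        exact Finset.disjoint_left.1 hcA (ParentTree.mem_pdesc.2 ⟨hh, h5⟩) hv'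
      refine key v hv _ ?_
      rw [hh, show D.depth c + ℓ - D.depth c = ℓ by omega]
      exact hx)
    (fun v hv hv' x hx => by
      refine key v hv _ ?_
      obtain ⟨⟨h1, h2⟩, h3⟩ := ParentTree.mem_near.1 hv
      have h4 := D.depth_par v (h2.par_of_ne h1).1
      simp only [hBdef] at hx
      rw [if_neg (by omega)] at hx
      exact (Finset.mem_inter.1 hx).1)
  refine ⟨φ', h1, h2, fun v hv => ?_, fun v hv => ?_⟩
  · obtain ⟨h4, h5⟩ := ParentTree.mem_near.1 hv
    have := h3 v (ParentTree.mem_near.2 ⟨h4, by omega⟩)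
    simp only [hBdef] at this
    rw [if_neg (by omega)] at this
    exact (Finset.mem_inter.1 this).2
  · obtain ⟨h4, h5⟩ := ParentTree.mem_descAt.1 hv
    have := h3 v (ParentTree.mem_near.2 ⟨⟨by rintro rfl; omega, h4⟩, by omega⟩)
    simp only [hBdef] at this
    rwa [if_pos (by omega)] at this

/-- A partial embedding of the whole tree is a copy. -/
lemma isContained {T : SimpleGraph W} (h : IsPartialEmb D G Finset.univ φ)
    (hT : ∀ x y, T.Adj x y → (x ≠ D.root ∧ D.par x = y) ∨ (y ≠ D.root ∧ D.par y = x)) :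
    T.IsContained G := by
  refine ⟨⟨⟨φ, fun {x y} hxy => ?_⟩, fun x y hxy => h.inj (by simp) (by simp) hxy⟩⟩
  rcases hT x y hxy with ⟨h1, rfl⟩ | ⟨h1, rfl⟩
  · exact (h.adj x (by simp) h1).symm
  · exact h.adj y (by simp) h1

end IsPartialEmb

/-! ### Cut-density: every set is reachable in few steps -/

namespace SimpleGraph

variable {V : Type*} (G : SimpleGraph V)

/-- Every partition of the vertex set `S` into `A` and `B` has at least `q |A| |B|` edges of `G`
between `A` and `B`. -/
def CutDenseOn (q : ℝ) (S : Finset V) : Prop :=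
  ∀ A B : Finset V, Disjoint A B → A ∪ B = S →
    q * (A.card : ℝ) * (B.card : ℝ) ≤ ∑ v ∈ A, ((G.nbrIn v B).card : ℝ)

variable {G}

lemma sum_card_nbrIn_comm (A B : Finset V) :
    ∑ v ∈ A, ((G.nbrIn v B).card : ℝ) = ∑ v ∈ B, ((G.nbrIn v A).card : ℝ) := by
  have h := Finset.sum_card_bipartiteAbove_eq_sum_card_bipartiteBelow (s := A) (t := B) G.Adj
  have h' : ∑ v ∈ A, (G.nbrIn v B).card = ∑ v ∈ B, (G.nbrIn v A).card := by
    refine h.trans (Finset.sum_congr rfl fun y _ => ?_)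
    simp only [Finset.bipartiteBelow, nbrIn, G.adj_comm y]
  exact_mod_cast h'

lemma card_interedges_eq_sum (A B : Finset V) :
    (G.interedges A B).card = ∑ v ∈ A, (G.nbrIn v B).card := by
  simp only [interedges, Rel.interedges, nbrIn, Finset.card_filter, Finset.sum_product]

lemma CutDenseOn.le_card_nbrIn {q : ℝ} {S : Finset V} (h : G.CutDenseOn q S) {v : V}
    (hv : v ∈ S) : q * ((S.card : ℝ) - 1) ≤ (G.nbrIn v S).card := by
  have h1 := h {v} (S.erase v) (by simp) (by
    rw [Finset.singleton_union, Finset.insert_erase hv])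
  rw [Finset.card_singleton, Finset.sum_singleton, Finset.card_erase_of_mem hv,
    Nat.cast_sub (Finset.card_pos.2 ⟨v, hv⟩)] at h1
  have h2 : ((G.nbrIn v (S.erase v)).card : ℝ) ≤ (G.nbrIn v S).card := by
    exact_mod_cast Finset.card_le_card (nbrIn_mono v (Finset.erase_subset _ _))
  push_cast at h1
  linarith

lemma CutDenseOn.mono {q q' : ℝ} (hq : q' ≤ q) {S : Finset V} (h : G.CutDenseOn q S) :
    G.CutDenseOn q' S := by
  intro A B h1 h2
  refine le_trans ?_ (h A B h1 h2)
  gcongr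

/-- The vertices of `S` from which there are many walks of length `i` in `S` ending in a vertex
with many neighbours in `Y`. -/
noncomputable def level (G : SimpleGraph V) (S Y : Finset V) (θ₀ θ : ℝ) : ℕ → Finset V
  | 0 => {v ∈ S | θ₀ ≤ ((G.nbrIn v Y).card : ℝ)}
  | i + 1 => {v ∈ S | θ ≤ ((G.nbrIn v (level G S Y θ₀ θ i)).card : ℝ)}

lemma level_subset (S Y : Finset V) (θ₀ θ : ℝ) (i : ℕ) : G.level S Y θ₀ θ i ⊆ S := by
  cases i <;> exact Finset.filter_subset _ _

lemma le_of_mem_level_zero {S Y : Finset V} {θ₀ θ : ℝ} {v : V} (h : v ∈ G.level S Y θ₀ θ 0) :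
    θ₀ ≤ ((G.nbrIn v Y).card : ℝ) := (Finset.mem_filter.1 h).2

lemma le_of_mem_level_succ {S Y : Finset V} {θ₀ θ : ℝ} {v : V} {i : ℕ}
    (h : v ∈ G.level S Y θ₀ θ (i + 1)) :
    θ ≤ ((G.nbrIn v (G.level S Y θ₀ θ i)).card : ℝ) := (Finset.mem_filter.1 h).2

/-- A counting form of Markov's inequality. -/
lemma le_card_filter_of_sum {ι : Type*} {s : Finset ι} {f : ι → ℝ} {m a T : ℝ} (ha : 0 ≤ a)
    (hm : ∀ i ∈ s, f i ≤ m) (hT : T ≤ ∑ i ∈ s, f i) :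
    T - s.card * a ≤ ({i ∈ s | a ≤ f i} : Finset ι).card * m := by
  have h1 : ∑ i ∈ s, f i = ∑ i ∈ s with a ≤ f i, f i + ∑ i ∈ s with ¬ a ≤ f i, f i :=
    (Finset.sum_filter_add_sum_filter_not s _ _).symm
  have h2 : ∑ i ∈ s with a ≤ f i, f i ≤ ({i ∈ s | a ≤ f i} : Finset ι).card * m := by
    rw [← nsmul_eq_mul]
    exact Finset.sum_le_card_nsmul _ _ _ fun i hi => hm i (Finset.mem_filter.1 hi).1
  have h3 : ∑ i ∈ s with ¬ a ≤ f i, f i ≤ s.card * a := by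
    refine (Finset.sum_le_card_nsmul _ _ a fun i hi =>
      (not_le.1 (Finset.mem_filter.1 hi).2).le).trans ?_
    rw [nsmul_eq_mul]
    gcongr
    exact Finset.filter_subset _ _
  linarith

/-- The union `U i` of the first levels starts with at least `q n / 4` vertices and gains at least
`q² n / 8` per step while more than `q n / 4` vertices are missing. As `C q² ≥ 8`, at most `q n / 4`
are missing after `C` steps. Every vertex has degree at least `q n / 2`, so one further step reaches
all of them. -/
lemma CutDenseOn.exists_mem_level {q : ℝ} (hq : 0 < q) (hq1 : q ≤ 1) {S Y : Finset V}
    (h : G.CutDenseOn q S) (hS : 2 ≤ S.card) (hYS : Y ⊆ S) (hY : Y.Nonempty) {C : ℕ}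
    (hC : 8 ≤ C * q ^ 2) {x : V} (hx : x ∈ S) :
    ∃ i ≤ C + 1, x ∈ G.level S Y (q * Y.card / 4) (q ^ 2 * S.card / (8 * (C + 2))) i := by
  set n : ℝ := (S.card : ℝ) with hn
  set θ₀ := q * Y.card / 4 with hθ₀
  set θ := q ^ 2 * n / (8 * (C + 2)) with hθ
  have hn2 : (2 : ℝ) ≤ n := by rw [hn]; exact_mod_cast hS
  have hdeg : ∀ v ∈ S, q * n / 2 ≤ (G.nbrIn v S).card := fun v hv => by
    have := h.le_card_nbrIn hv
    nlinarith
  set U : ℕ → Finset V := fun i => (Finset.range (i + 1)).biUnion (G.level S Y θ₀ θ) with hU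
  have hUS : ∀ i, U i ⊆ S := fun i => Finset.biUnion_subset.2 fun j _ => level_subset _ _ _ _ _
  have hUmono : ∀ i, U i ⊆ U (i + 1) := fun i =>
    Finset.biUnion_subset_biUnion_of_subset_left _ (Finset.range_mono (by omega))
  -- Pigeonhole: neighbours in `U i` are shared among at most `C + 2` levels, so one level receives
  -- `θ` of them. This is the source of the denominator of `θ`.
  have hstep : ∀ i < C + 1, ∀ v ∈ S, q ^ 2 * n / 8 ≤ (G.nbrIn v (U i)).card → v ∈ U (i + 1) := by
    intro i hi v hv hcard
    by_contra hnot
    have hlt : ∀ j ∈ Finset.range (i + 1), ((G.nbrIn v (G.level S Y θ₀ θ j)).card : ℝ) < θ := by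
      intro j hj
      by_contra hge
      refine hnot (Finset.mem_biUnion.2 ⟨j + 1, ?_, Finset.mem_filter.2 ⟨hv, not_lt.1 hge⟩⟩)
      rw [Finset.mem_range] at hj ⊢; omega
    have h1 : G.nbrIn v (U i) ⊆
        (Finset.range (i + 1)).biUnion fun j => G.nbrIn v (G.level S Y θ₀ θ j) := by
      intro y hy
      rw [mem_nbrIn, Finset.mem_biUnion] at hy
      obtain ⟨⟨j, hj, hyj⟩, hadj⟩ := hy
      exact Finset.mem_biUnion.2 ⟨j, hj, mem_nbrIn.2 ⟨hyj, hadj⟩⟩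
    have h2 : ((G.nbrIn v (U i)).card : ℝ) ≤
        ∑ j ∈ Finset.range (i + 1), ((G.nbrIn v (G.level S Y θ₀ θ j)).card : ℝ) := by
      exact_mod_cast (Finset.card_le_card h1).trans Finset.card_biUnion_le
    have h3 := Finset.sum_lt_sum_of_nonempty (s := Finset.range (i + 1)) ⟨0, by simp⟩ hlt
    rw [Finset.sum_const, Finset.card_range, nsmul_eq_mul] at h3
    have h4 : ((i + 1 : ℕ) : ℝ) * θ ≤ (C + 2) * θ := by
      have : ((i + 1 : ℕ) : ℝ) ≤ C + 2 := by exact_mod_cast (by omega : i + 1 ≤ C + 2)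
      have : 0 ≤ θ := by positivity
      gcongr
    have h5 : ((C : ℝ) + 2) * θ = q ^ 2 * n / 8 := by rw [hθ]; field_simp
    linarith
  have hU0 : q * n / 4 ≤ (U 0).card := by
    have hY0 : (0 : ℝ) < Y.card := by exact_mod_cast Finset.card_pos.2 hY
    have h1 : (Y.card : ℝ) * (q * n / 2) ≤ ∑ v ∈ S, ((G.nbrIn v Y).card : ℝ) := by
      rw [sum_card_nbrIn_comm, ← nsmul_eq_mul]
      exact Finset.card_nsmul_le_sum _ _ _ fun v hv => hdeg v (hYS hv)
    have h2 := le_card_filter_of_sum (a := θ₀) (m := Y.card) (by positivity)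
      (fun v _ => by exact_mod_cast Finset.card_le_card (nbrIn_subset (G := G) v Y)) h1
    have h3 : U 0 = {v ∈ S | θ₀ ≤ ((G.nbrIn v Y).card : ℝ)} := by
      simp [hU, level]
    rw [h3]
    rw [← hn, hθ₀] at h2
    refine le_of_mul_le_mul_right ?_ hY0
    refine le_trans (le_of_eq ?_) h2
    ring
  have hUi : ∀ i, q * n / 4 ≤ (U i).card := fun i => by
    induction i with
    | zero => exact hU0
    | succ i ih => exact ih.trans (by exact_mod_cast Finset.card_le_card (hUmono i))
  have hgrow : ∀ i ≤ C, i * (q ^ 2 * n / 8) ≤ (U i).card ∨ n - (U i).card ≤ q * n / 4 := by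
    intro i
    induction i with
    | zero => intro _; left; simp
    | succ i ih =>
      intro hi
      have hm : ((U i).card : ℝ) ≤ (U (i + 1)).card := by
        exact_mod_cast Finset.card_le_card (hUmono i)
      by_cases hsmall : n - (U i).card ≤ q * n / 4
      · right; linarith
      left
      have hI := (ih (by omega)).resolve_right hsmall
      set z : ℝ := ((U i).card : ℝ) with hz
      have hz0 : 0 < z := lt_of_lt_of_le (by positivity) (hUi i)
      have hb : ((S \ U i).card : ℝ) = n - z := by
        rw [Finset.card_sdiff_of_subset (hUS i), Nat.cast_sub (Finset.card_le_card (hUS i))]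
      -- The cut has at least `q (n - z) z` edges, so by Markov at least `q (n - z) / 2` outside
      -- vertices have `q z / 2 ≥ q² n / 8` neighbours in `U i`; all of them join `U (i + 1)`.
      have h1 := h (S \ U i) (U i) Finset.sdiff_disjoint (Finset.sdiff_union_of_subset (hUS i))
      have h2 := le_card_filter_of_sum (a := q * z / 2) (m := z) (by positivity)
        (fun v _ => by rw [hz]; exact_mod_cast Finset.card_le_card (nbrIn_subset (G := G) v (U i)))
        h1
      rw [hb] at h2
      set B' := ({v ∈ S \ U i | q * z / 2 ≤ ((G.nbrIn v (U i)).card : ℝ)} : Finset V) with hB'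
      have h3 : q * (n - z) / 2 ≤ B'.card := by
        refine le_of_mul_le_mul_right ?_ hz0
        refine le_trans (le_of_eq ?_) h2
        ring
      have h4 : U i ∪ B' ⊆ U (i + 1) := by
        refine Finset.union_subset (hUmono i) fun v hv => ?_
        obtain ⟨h5, h6⟩ := Finset.mem_filter.1 hv
        refine hstep i (by omega) v (Finset.mem_sdiff.1 h5).1 (le_trans ?_ h6)
        have := hUi i
        nlinarith
      have h5 : Disjoint (U i) B' := by
        rw [Finset.disjoint_left]
        intro v hv hv'
        exact (Finset.mem_sdiff.1 (Finset.mem_filter.1 hv').1).2 hv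
      have h6 : z + B'.card ≤ (U (i + 1)).card := by
        have := Finset.card_le_card h4
        rw [Finset.card_union_of_disjoint h5] at this
        rw [hz]; exact_mod_cast this
      push_cast
      nlinarith
  have hlast : n - (U C).card ≤ q * n / 4 := by
    rcases hgrow C le_rfl with h1 | h1
    · have : n ≤ (U C).card := by nlinarith
      have : 0 ≤ q * n / 4 := by positivity
      linarith
    · exact h1
  have hfin : x ∈ U (C + 1) := by
    refine hstep C (by omega) x hx ?_
    have h1 := card_nbrIn_le_sdiff_add (G := G) x S (S \ U C)
    rw [Finset.sdiff_sdiff_eq_self (hUS C), Finset.inter_eq_right.2 Finset.sdiff_subset,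
      Finset.card_sdiff_of_subset (hUS C)] at h1
    have h2 : ((G.nbrIn x S).card : ℝ) ≤ (G.nbrIn x (U C)).card + (n - (U C).card) := by
      rw [hn, ← Nat.cast_sub (Finset.card_le_card (hUS C))]
      exact_mod_cast h1
    have h3 := hdeg x hx
    have h4 : q ^ 2 * n ≤ q * n :=
      mul_le_mul_of_nonneg_right (by nlinarith) (by linarith)
    have : 0 ≤ q * n := by positivity
    linarith
  obtain ⟨i, hi, hxi⟩ := Finset.mem_biUnion.1 hfin
  exact ⟨i, by rw [Finset.mem_range] at hi; omega, hxi⟩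

end SimpleGraph

/-! ### Hitting sets and reservoirs -/

/-- Greedy construction of a set of `w` elements that meets most of the sets `F i`. -/
lemma Finset.exists_hitting {V ι : Type*} (I : Finset ι) (F : ι → Finset V) (S : Finset V)
    (hS : S.Nonempty) (hF : ∀ i ∈ I, F i ⊆ S) {a : ℝ} (ha1 : a ≤ 1)
    (ha : ∀ i ∈ I, a * S.card ≤ (F i).card) (w : ℕ) :
    ∃ X ⊆ S, X.card ≤ w ∧
      (({i ∈ I | Disjoint (F i) X} : Finset ι).card : ℝ) ≤ (1 - a) ^ w * I.card := by
  induction w with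
  | zero => exact ⟨∅, by simp, by simp, by simp⟩
  | succ w ih =>
    obtain ⟨X, hXS, hXc, hX⟩ := ih
    set J := ({i ∈ I | Disjoint (F i) X} : Finset ι) with hJ
    have hS0 : (0 : ℝ) < S.card := by exact_mod_cast hS.card_pos
    have h1 : ∑ x ∈ S, (({i ∈ J | x ∈ F i} : Finset ι).card : ℝ) = ∑ i ∈ J, ((F i).card : ℝ) := by
      have h := Finset.sum_card_bipartiteAbove_eq_sum_card_bipartiteBelow (s := S) (t := J)
        (fun x i => x ∈ F i)
      have h' : ∑ x ∈ S, ({i ∈ J | x ∈ F i} : Finset ι).card = ∑ i ∈ J, (F i).card := by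
        refine h.trans (Finset.sum_congr rfl fun i hi => ?_)
        rw [Finset.bipartiteBelow, Finset.filter_mem_eq_inter,
          Finset.inter_eq_right.2 (hF i (Finset.mem_filter.1 hi).1)]
      exact_mod_cast h'
    have h2 : (J.card : ℝ) * (a * S.card) ≤ ∑ i ∈ J, ((F i).card : ℝ) := by
      rw [← nsmul_eq_mul]
      exact Finset.card_nsmul_le_sum _ _ _ fun i hi => ha i (Finset.mem_filter.1 hi).1
    -- By averaging, some `x` lies in at least a proportion `a` of the sets not yet met.
    obtain ⟨x, hxS, hx⟩ := Finset.exists_le_of_sum_le (s := S) (f := fun _ => a * J.card)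
      (g := fun x => (({i ∈ J | x ∈ F i} : Finset ι).card : ℝ)) hS (by
        rw [h1, Finset.sum_const, nsmul_eq_mul]; linarith)
    refine ⟨insert x X, Finset.insert_subset hxS hXS, (Finset.card_insert_le _ _).trans (by omega),
      ?_⟩
    have h3 : ({i ∈ I | Disjoint (F i) (insert x X)} : Finset ι) = J \ {i ∈ J | x ∈ F i} := by
      ext i
      simp only [hJ, Finset.mem_filter, Finset.mem_sdiff, Finset.disjoint_insert_right]
      tauto
    rw [h3, Finset.card_sdiff_of_subset (Finset.filter_subset _ _),
      Nat.cast_sub (Finset.card_le_card (Finset.filter_subset _ _)), pow_succ]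
    have h4 : (1 - a) * J.card ≤ (1 - a) * ((1 - a) ^ w * I.card) :=
      mul_le_mul_of_nonneg_left hX (by linarith)
    linarith

/-- A small set that meets each of the sets `F i` in at least `K` elements. -/
lemma Finset.exists_multi_hitting {V ι : Type*} (I : Finset ι) (F : ι → Finset V) (S : Finset V)
    (hS : S.Nonempty) (hF : ∀ i ∈ I, F i ⊆ S) {a : ℝ} (ha1 : a ≤ 1)
    (ha : ∀ i ∈ I, a * S.card ≤ (F i).card) {w : ℕ} (hw : (1 - a / 2) ^ w * I.card < 1)
    (K : ℕ) (hK : (K : ℝ) * w ≤ a / 2 * S.card) :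
    ∃ X ⊆ S, X.card ≤ K * w ∧ ∀ i ∈ I, K ≤ (F i ∩ X).card := by
  induction K with
  | zero => exact ⟨∅, by simp, by simp, by simp⟩
  | succ K ih =>
    push_cast at hK
    obtain ⟨X, hXS, hXc, hX⟩ := ih (by nlinarith)
    have hXc' : (X.card : ℝ) ≤ K * w := by exact_mod_cast hXc
    -- Each round hits every set in a new element: the earlier rounds used at most `a / 2 * S.card`
    -- elements, so the sets `F i \ X` still have density `a / 2`. The bound `hw` leaves fewer than
    -- one set unmet.
    obtain ⟨X', hXS', hXc2, hX'⟩ := Finset.exists_hitting I (fun i => F i \ X) S hS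
      (fun i hi => Finset.sdiff_subset.trans (hF i hi)) (a := a / 2) (by linarith)
      (fun i hi => by
        have h1 : ((F i).card : ℝ) ≤ (F i \ X).card + X.card := by
          exact_mod_cast Finset.card_le_card_sdiff_add_card
        have h2 := ha i hi
        have : (0 : ℝ) ≤ w := by positivity
        linarith) w
    refine ⟨X ∪ X', Finset.union_subset hXS hXS', (Finset.card_union_le _ _).trans (by
      rw [add_mul]; omega), fun i hi => ?_⟩
    have h0 : ({i ∈ I | Disjoint (F i \ X) X'} : Finset ι).card = 0 := by
      have := hX'.trans_lt hw
      exact Nat.lt_one_iff.1 (by exact_mod_cast this)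
    have h1 : ¬ Disjoint (F i \ X) X' := fun hd => by
      exact Finset.notMem_empty i (Finset.card_eq_zero.1 h0 ▸ Finset.mem_filter.2 ⟨hi, hd⟩)
    obtain ⟨y, hy, hy'⟩ := Finset.not_disjoint_iff.1 h1
    rw [Finset.mem_sdiff] at hy
    have h2 : insert y (F i ∩ X) ⊆ F i ∩ (X ∪ X') := by
      intro z hz
      rcases Finset.mem_insert.1 hz with rfl | hz
      · exact Finset.mem_inter.2 ⟨hy.1, Finset.mem_union_right _ hy'⟩
      · exact Finset.inter_subset_inter_left Finset.subset_union_left hz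
    have h3 := Finset.card_le_card h2
    rw [Finset.card_insert_of_notMem (by simp [hy.2])] at h3
    have := hX i hi
    omega

/-- Exponential decay in a linear number of choices beats the polynomial number of sets that a
reservoir must hit. -/
lemma exists_forall_pow_mul_pow_floor_lt_one {r : ℝ} (hr0 : 0 ≤ r) (hr1 : r < 1) (k : ℕ) {c β : ℝ}
    (hc : 0 ≤ c) (hβ : 0 < β) :
    ∃ n₀ : ℕ, ∀ n : ℕ, n₀ ≤ n → r ^ ⌊β * n⌋₊ * (c * (n : ℝ) ^ k) < 1 := by
  have h1 : Filter.Tendsto (fun w : ℕ => c * (2 / β) ^ k * ((w : ℝ) ^ k * r ^ w)) Filter.atTop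
      (nhds (c * (2 / β) ^ k * 0)) :=
    (tendsto_pow_const_mul_const_pow_of_lt_one k hr0 hr1).const_mul _
  rw [mul_zero] at h1
  obtain ⟨w₀, hw₀⟩ := Filter.eventually_atTop.1 (h1.eventually (gt_mem_nhds one_pos))
  refine ⟨⌈(w₀ + 1) / β⌉₊, fun n hn => ?_⟩
  have h2 : ((w₀ : ℝ) + 1) ≤ β * n := by
    have := Nat.ceil_le.1 hn
    rw [div_le_iff₀ hβ] at this
    linarith
  have h3 : w₀ + 1 ≤ ⌊β * n⌋₊ := Nat.le_floor (by exact_mod_cast h2)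
  set w := ⌊β * n⌋₊
  have h4 : β * n < w + 1 := Nat.lt_floor_add_one _
  have h5 : (1 : ℝ) ≤ w := by exact_mod_cast (by omega : 1 ≤ w)
  have h6 : (n : ℝ) ≤ 2 / β * w := by
    rw [div_mul_eq_mul_div, le_div_iff₀ hβ]; linarith
  calc r ^ w * (c * (n : ℝ) ^ k) ≤ r ^ w * (c * (2 / β * w) ^ k) := by gcongr
    _ = c * (2 / β) ^ k * ((w : ℝ) ^ k * r ^ w) := by rw [mul_pow]; ring
    _ < 1 := hw₀ w (by omega)

/-- In a large cut-dense graph a small set `R` of vertices suffices to go, by walks of bounded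
length with many choices in each step, from any vertex `x` to any set `Y` of `N` vertices. -/
theorem exists_reservoir {q : ℝ} (hq : 0 < q) (hq1 : q ≤ 1) :
    ∃ C : ℕ, ∀ (N K : ℕ) (ξ : ℝ), 1 ≤ N → 0 < ξ → ∃ n₀ : ℕ,
      ∀ {V : Type*} (G : SimpleGraph V) (S : Finset V), n₀ ≤ S.card → G.CutDenseOn q S →
        ∃ R ⊆ S, (R.card : ℝ) ≤ ξ * S.card ∧ ∀ Y ⊆ S, Y.card = N → ∀ x ∈ S,
          ∃ ℓ ≤ C, ∃ Z : ℕ → Finset V, x ∈ Z ℓ ∧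
            (∀ v ∈ Z 0, q * N / 4 ≤ ((G.nbrIn v Y).card : ℝ)) ∧
            ∀ i < ℓ, ∀ v ∈ Z (i + 1), K ≤ (G.nbrIn v (Z i ∩ R)).card := by
  obtain ⟨C, hC⟩ := exists_nat_ge (8 / q ^ 2)
  rw [div_le_iff₀ (by positivity)] at hC
  refine ⟨C + 1, fun N K ξ hN hξ => ?_⟩
  set a : ℝ := q ^ 2 / (8 * (C + 2)) with ha
  have ha0 : 0 < a := by positivity
  have ha1 : a ≤ 1 := by
    rw [ha, div_le_one (by positivity)]
    nlinarith [(Nat.cast_nonneg C : (0 : ℝ) ≤ C)]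
  -- With this `β`, `K` rounds of `w` elements stay within both the allowed size `ξ * S.card` and
  -- the `a / 2 * S.card` that repeated hitting tolerates.
  set β : ℝ := min ξ (a / 2) / (K + 1) with hβ
  have hβ0 : 0 < β := div_pos (lt_min hξ (by positivity)) (by positivity)
  obtain ⟨n₀, hn₀⟩ := exists_forall_pow_mul_pow_floor_lt_one (r := 1 - a / 2) (by linarith)
    (by linarith) (N + 1) (c := C + 1) (β := β) (by positivity) hβ0
  refine ⟨max n₀ 2, fun {V} G S hS hG => ?_⟩
  have hS2 : 2 ≤ S.card := (le_max_right _ _).trans hS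
  set Z : Finset V → ℕ → Finset V := fun Y => G.level S Y (q * N / 4) (a * S.card) with hZ
  set F : Finset V × V × ℕ → Finset V := fun i => G.nbrIn i.2.1 (Z i.1 i.2.2) with hF
  set J : Finset (Finset V × V × ℕ) := S.powersetCard N ×ˢ S ×ˢ Finset.range (C + 1) with hJ
  -- A triple records a target `Y`, a vertex and a level. Since `N` is fixed, their number is
  -- polynomial in `S.card`.
  set I : Finset (Finset V × V × ℕ) := {i ∈ J | a * S.card ≤ ((F i).card : ℝ)} with hI
  set w := ⌊β * S.card⌋₊ with hw
  have hwle : (w : ℝ) ≤ β * S.card := Nat.floor_le (by positivity)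
  have hIc : (I.card : ℝ) ≤ (C + 1) * (S.card : ℝ) ^ (N + 1) := by
    have h1 : I.card ≤ S.card ^ N * (S.card * (C + 1)) := by
      refine (Finset.card_filter_le _ _).trans ?_
      rw [hJ, Finset.card_product, Finset.card_product, Finset.card_range,
        Finset.card_powersetCard]
      exact Nat.mul_le_mul_right _ (Nat.choose_le_pow _ _)
    have h2 : (I.card : ℝ) ≤ (S.card : ℝ) ^ N * (S.card * (C + 1)) := by exact_mod_cast h1
    refine h2.trans (le_of_eq ?_)
    ring
  have hKw : (K : ℝ) * w ≤ min ξ (a / 2) * S.card := by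
    have h1 : (K : ℝ) * w ≤ (K + 1) * (β * S.card) := by
      have : (0 : ℝ) ≤ w := by positivity
      nlinarith
    have h2 : ((K : ℝ) + 1) * β = min ξ (a / 2) := by rw [hβ]; field_simp
    calc (K : ℝ) * w ≤ (K + 1) * (β * S.card) := h1
      _ = min ξ (a / 2) * S.card := by rw [← mul_assoc, h2]
  obtain ⟨R, hRS, hRc, hR⟩ := Finset.exists_multi_hitting I F S (Finset.card_pos.1 (by omega))
    (fun i _ => (nbrIn_subset _ _).trans (level_subset _ _ _ _ _)) ha1
    (fun i hi => (Finset.mem_filter.1 hi).2) (w := w)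
    ((mul_le_mul_of_nonneg_left hIc (pow_nonneg (by linarith) _)).trans_lt
      (hn₀ _ ((le_max_left _ _).trans hS))) K
    (hKw.trans (by gcongr; exact min_le_right _ _))
  refine ⟨R, hRS, ?_, fun Y hYS hYN x hx => ?_⟩
  · have h1 : (R.card : ℝ) ≤ K * w := by exact_mod_cast hRc
    exact h1.trans (hKw.trans (by gcongr; exact min_le_left _ _))
  · obtain ⟨ℓ, hℓ, hxℓ⟩ := hG.exists_mem_level hq hq1 hS2 hYS
      (Finset.card_pos.1 (by omega)) hC hx
    have haS : q ^ 2 * S.card / (8 * ((C : ℝ) + 2)) = a * S.card := by rw [ha]; ring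
    rw [hYN, haS] at hxℓ
    refine ⟨ℓ, hℓ, Z Y, hxℓ, fun v hv => le_of_mem_level_zero hv, fun i hi v hv => ?_⟩
    have hmem : (Y, v, i) ∈ I := by
      refine Finset.mem_filter.2 ⟨?_, le_of_mem_level_succ hv⟩
      simp only [hJ, Finset.mem_product, Finset.mem_powersetCard, Finset.mem_range]
      exact ⟨⟨hYS, hYN⟩, level_subset _ _ _ _ _ hv, by omega⟩
    refine (hR _ hmem).trans (Finset.card_le_card fun y hy => ?_)
    rw [Finset.mem_inter, mem_nbrIn] at hy
    exact mem_nbrIn.2 ⟨Finset.mem_inter.2 ⟨hy.1.1, hy.2⟩, hy.1.2⟩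

/-! ### Splitting off tops; subsets of large minimum degree -/

namespace ParentTree

variable {W : Type*} [Fintype W] {D : ParentTree W}

lemma pdesc_eq_top_union {w o : W} (ho : D.IsDesc w o) :
    D.pdesc w = (D.desc w \ D.pdesc o).erase w ∪ D.pdesc o := by
  ext v
  simp only [Finset.mem_union, Finset.mem_erase, Finset.mem_sdiff, mem_desc, mem_pdesc]
  constructor
  · tauto
  · rintro (h | ⟨h1, h2⟩)
    · tauto
    · refine ⟨?_, ho.trans h2⟩
      rintro rfl
      exact h1 (h2.eq_of_depth_le ho.depth_le)

lemma par_mem_top {w o v : W} (hv : v ∈ (D.desc w \ D.pdesc o).erase w) :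
    v ≠ D.root ∧ (D.par v = w ∨ D.par v ∈ (D.desc w \ D.pdesc o).erase w) := by
  simp only [Finset.mem_erase, Finset.mem_sdiff, mem_desc, mem_pdesc] at hv ⊢
  obtain ⟨h1, h2, h3⟩ := hv
  obtain ⟨h4, h5⟩ := h2.par_of_ne h1
  refine ⟨h4, or_iff_not_imp_left.2 fun h6 => ⟨h6, h5, ?_⟩⟩
  rintro ⟨-, h7⟩
  refine h3 ⟨?_, h7.trans (isDesc_par v)⟩
  rintro rfl
  have := h7.depth_le
  have := D.depth_par v h4
  omega

end ParentTree

namespace SimpleGraph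

variable {V : Type*} {G : SimpleGraph V}

/-- A graph of average degree at least `2 k` has a subgraph of minimum degree at least `k`. -/
lemma exists_subset_min_degree {k : ℝ} (S : Finset V) (hS : S.Nonempty)
    (h : 2 * k * S.card ≤ ∑ v ∈ S, ((G.nbrIn v S).card : ℝ)) :
    ∃ H ⊆ S, H.Nonempty ∧ ∀ v ∈ H, k ≤ (G.nbrIn v H).card := by
  induction hn : S.card generalizing S with
  | zero => exact absurd hS (by simp [Finset.card_eq_zero.1 hn])
  | succ n ih =>
    by_cases hall : ∀ v ∈ S, k ≤ (G.nbrIn v S).card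
    · exact ⟨S, subset_rfl, hS, hall⟩
    push Not at hall
    obtain ⟨v, hv, hvk⟩ := hall
    have hc : (S.erase v).card = n := by rw [Finset.card_erase_of_mem hv, hn]; rfl
    -- Deleting `v` costs its degree twice, in its own term and across its neighbours: less than `2
    -- k`, so the average is kept.
    have hsum : ∑ u ∈ S, ((G.nbrIn u S).card : ℝ) ≤
        2 * (G.nbrIn v S).card + ∑ u ∈ S.erase v, ((G.nbrIn u (S.erase v)).card : ℝ) := by
      have h1 : ∀ u ∈ S.erase v, ((G.nbrIn u S).card : ℝ) ≤
          (G.nbrIn u (S.erase v)).card + (G.nbrIn u {v}).card := by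
        intro u _
        have : G.nbrIn u S ⊆ G.nbrIn u (S.erase v) ∪ G.nbrIn u {v} := by
          intro y hy
          simp only [Finset.mem_union, mem_nbrIn, Finset.mem_erase, Finset.mem_singleton] at hy ⊢
          tauto
        exact_mod_cast (Finset.card_le_card this).trans (Finset.card_union_le _ _)
      have h2 := Finset.sum_le_sum h1
      rw [Finset.sum_add_distrib, sum_card_nbrIn_comm _ {v}, Finset.sum_singleton] at h2
      have h3 : ((G.nbrIn v (S.erase v)).card : ℝ) ≤ (G.nbrIn v S).card := by
        exact_mod_cast Finset.card_le_card (nbrIn_mono v (Finset.erase_subset _ _))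
      rw [← Finset.add_sum_erase S _ hv]
      linarith
    rw [hn] at h
    push_cast at h
    have h0 : (0 : ℝ) ≤ (G.nbrIn v S).card := by positivity
    have hne : (S.erase v).Nonempty := by
      rw [← Finset.card_pos, hc]
      by_contra hn0
      have hn0 : n = 0 := by omega
      have h1 : S.erase v = ∅ := Finset.card_eq_zero.1 (hc.trans hn0)
      have h2 : S = {v} := by
        rw [← Finset.insert_erase hv, h1]; rfl
      rw [h2, Finset.sum_singleton, hn0] at h
      rw [h2] at hvk
      push_cast at h
      rw [h2] at h0
      linarith
    obtain ⟨H, h1, h2⟩ := ih (S.erase v) hne (by rw [hc]; linarith) hc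
    exact ⟨H, h1.trans (Finset.erase_subset _ _), h2⟩

/-- Deleting `X` from a `d`-regular graph on `F` destroys at most `d |X|` edges. -/
lemma le_sum_card_nbrIn_sdiff {d : ℝ} {F : Finset V} (hd : 0 ≤ d)
    (hF : ∀ v ∈ F, ((G.nbrIn v F).card : ℝ) = d) (X : Finset V) :
    ((F.card : ℝ) - 2 * X.card) * d ≤ ∑ v ∈ F \ X, ((G.nbrIn v (F \ X)).card : ℝ) := by
  have h1 : ∀ v ∈ F \ X, d ≤ ((G.nbrIn v (F \ X)).card : ℝ) + (G.nbrIn v (F ∩ X)).card := by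
    intro v hv
    rw [← hF v (Finset.mem_sdiff.1 hv).1]
    have : G.nbrIn v F ⊆ G.nbrIn v (F \ X) ∪ G.nbrIn v (F ∩ X) := by
      intro y hy
      simp only [Finset.mem_union, mem_nbrIn, Finset.mem_sdiff, Finset.mem_inter] at hy ⊢
      tauto
    exact_mod_cast (Finset.card_le_card this).trans (Finset.card_union_le _ _)
  have h2 := Finset.card_nsmul_le_sum _ _ _ h1
  rw [nsmul_eq_mul, Finset.sum_add_distrib, sum_card_nbrIn_comm _ (F ∩ X)] at h2
  have h3 : ∑ v ∈ F ∩ X, ((G.nbrIn v (F \ X)).card : ℝ) ≤ (F ∩ X).card * d := by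
    rw [← nsmul_eq_mul]
    refine Finset.sum_le_card_nsmul _ _ _ fun v hv => ?_
    rw [← hF v (Finset.mem_inter.1 hv).1]
    exact_mod_cast Finset.card_le_card (nbrIn_mono v Finset.sdiff_subset)
  have h4 : ((F \ X).card : ℝ) + (F ∩ X).card = F.card := by
    exact_mod_cast Finset.card_sdiff_add_card_inter F X
  have h5 : ((F ∩ X).card : ℝ) ≤ X.card := by
    exact_mod_cast Finset.card_le_card Finset.inter_subset_right
  nlinarith

lemma nbrIn_subset_of_le {G' : SimpleGraph V} (h : G' ≤ G) (v : V) (B : Finset V) :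
    G'.nbrIn v B ⊆ G.nbrIn v B := by
  intro y hy
  rw [mem_nbrIn] at hy ⊢
  exact ⟨hy.1, h hy.2⟩

end SimpleGraph

/-! ### Structure (i): embedding around a regular subgraph -/

/-- Suppose that `R` is a reservoir and that, whatever has been embedded, there remains a set `H`
of minimum degree at least `N + Δ ^ (C + 1) * τ` outside the reservoir. Then everything below `c`
can be embedded, if the subtrees below `c` have at most `k τ` vertices. -/
theorem IsPartialEmb.extend_pdesc {W V : Type*} [Fintype W] {D : ParentTree W} {G : SimpleGraph V}
    {Δ C N K τ : ℕ} (hΔ0 : 1 ≤ Δ) (hΔ : ∀ v, (D.children v).card ≤ Δ) (hτ : 1 ≤ τ) {R : Finset V}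
    (hR : ∀ Y : Finset V, Y.card = N → ∀ x, ∃ ℓ ≤ C, ∃ Z : ℕ → Finset V, x ∈ Z ℓ ∧
      (∀ v ∈ Z 0, (C + 1) * Δ ^ (C + 1) ≤ (G.nbrIn v Y).card) ∧
      ∀ i < ℓ, ∀ v ∈ Z (i + 1), K ≤ (G.nbrIn v (Z i ∩ R)).card)
    (hH : ∀ X : Finset V, X.card ≤ Fintype.card W → ∃ H : Finset V, Disjoint H R ∧ Disjoint H X ∧
      N ≤ H.card ∧ ∀ v ∈ H, N + Δ ^ (C + 1) * τ ≤ (G.nbrIn v H).card)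
    (k : ℕ) : ∀ (A : Finset W) (φ : W → V) (c : W), IsPartialEmb D G A φ → c ∈ A →
      Disjoint (D.pdesc c) A → (∀ x ∈ D.pdesc c, (D.desc x).card ≤ k * τ) →
      (A.image φ ∩ R).card + ((C + 2) * Δ ^ (C + 1)) ^ k ≤ K →
      ∃ φ' : W → V, (∀ v ∈ A, φ' v = φ v) ∧ IsPartialEmb D G (A ∪ D.pdesc c) φ' ∧
        ((A ∪ D.pdesc c).image φ' ∩ R).card ≤
          (A.image φ ∩ R).card + ((C + 2) * Δ ^ (C + 1)) ^ k := by
  induction k with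
  | zero =>
    intro A φ c h hc hcA hsz _
    have he : D.pdesc c = ∅ := by
      refine Finset.eq_empty_of_forall_notMem fun x hx => ?_
      have h1 := hsz x hx
      have h2 := Finset.card_pos.2 ⟨x, D.self_mem_desc x⟩
      omega
    rw [he, Finset.union_empty]
    exact ⟨φ, fun _ _ => rfl, h, by omega⟩
  | succ k ih =>
    intro A φ c h hc hcA hsz hK
    set b := Δ ^ (C + 1) with hb
    set P := (C + 2) * b with hP
    have hb0 : 1 ≤ b := Nat.one_le_pow _ _ hΔ0
    have hP1 : 1 ≤ P := Nat.mul_pos (by omega) hb0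
    -- The reservoir budget: one descent, followed by at most `b` recursive calls.
    have hPk : (C + 1) * b + b * P ^ k ≤ P ^ (k + 1) := by
      have h1 : 1 ≤ P ^ k := Nat.one_le_pow _ _ hP1
      have h2 : P ^ (k + 1) = (C + 1) * b * P ^ k + b * P ^ k := by rw [pow_succ, hP]; ring
      rw [h2]
      have := Nat.mul_le_mul_left ((C + 1) * b) h1
      omega
    obtain ⟨H, hHR, hHA, hHN, hHdeg⟩ := hH (A.image φ)
      (Finset.card_image_le.trans (Finset.card_le_univ A))
    obtain ⟨Y, hYH, hYN⟩ := Finset.exists_subset_card_eq hHN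
    obtain ⟨ℓ, hℓ, Z, hcZ, hZ0, hZ⟩ := hR Y hYN (φ c)
    obtain ⟨φ₁, hφ₁, h₁, hnear, hlast⟩ := h.descend hc hcA hΔ0 hΔ hℓ R Y Z hcZ
      (fun v hv => by
        rw [Finset.sdiff_eq_self_of_disjoint (hHA.mono_left hYH)]
        exact hZ0 v hv)
      (fun i hi v hv => by
        have h1 := hZ i hi v hv
        have h2 := card_nbrIn_le_sdiff_add (G := G) v (Z i ∩ R) (A.image φ)
        have h3 : (Z i ∩ R ∩ A.image φ).card ≤ (A.image φ ∩ R).card := by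
          refine Finset.card_le_card fun y hy => ?_
          simp only [Finset.mem_inter] at hy ⊢
          tauto
        have : (C + 1) * Δ ^ (C + 1) ≤ (C + 1) * b + b * P ^ k := Nat.le_add_right _ _
        omega)
    set A₁ := A ∪ D.near c (ℓ + 1) with hA₁
    set L := D.descAt c (ℓ + 1) with hL
    have hLc : L.card ≤ b := (D.card_descAt_le hΔ c _).trans
      (Nat.pow_le_pow_right hΔ0 (by omega))
    have hLdesc : ∀ w ∈ L, w ∈ D.pdesc c ∧ w ∈ A₁ ∧ D.IsDesc c w ∧
        D.depth w = D.depth c + (ℓ + 1) := by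
      intro w hw
      obtain ⟨h1, h2⟩ := D.mem_descAt.1 hw
      have h3 : w ≠ c := by rintro rfl; omega
      exact ⟨D.mem_pdesc.2 ⟨h3, h1⟩,
        Finset.mem_union_right _ (D.mem_near.2 ⟨⟨h3, h1⟩, h2.le⟩), h1, h2⟩
    have hbelow : ∀ w ∈ L, ∀ v, D.IsDesc w v → v ≠ w → v ∉ A₁ := by
      intro w hw v hwv hne hv
      obtain ⟨h1, h2, h3, h4⟩ := hLdesc w hw
      have h5 := hwv.depth_lt hne
      rcases Finset.mem_union.1 hv with hv | hv
      · exact Finset.disjoint_left.1 hcA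
          (D.mem_pdesc.2 ⟨by rintro rfl; omega, h3.trans hwv⟩) hv
      · have := (D.mem_near.1 hv).2
        omega
    have hLeq : ∀ w ∈ L, ∀ w' ∈ L, ∀ v, D.IsDesc w v → D.IsDesc w' v → w = w' :=
      fun w hw w' hw' v hv hv' =>
        hv.eq_of_depth_eq hv' ((hLdesc w hw).2.2.2.trans (hLdesc w' hw').2.2.2.symm)
    choose o ho hoc hosz using fun w : W => D.exists_top w hτ
    set Q : W → Finset W := fun w => (D.desc w \ D.pdesc (o w)).erase w with hQ
    have hQdesc : ∀ w v, v ∈ Q w → D.IsDesc w v ∧ v ≠ w ∧ v ∉ D.pdesc (o w) := by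
      intro w v hv
      simp only [hQ, Finset.mem_erase, Finset.mem_sdiff, D.mem_desc] at hv
      tauto
    set N₃ := L.biUnion Q with hN₃
    have hN₃c : N₃.card ≤ b * τ :=
      (Finset.card_biUnion_le_card_mul _ _ τ fun w _ =>
        (Finset.card_le_card (Finset.erase_subset _ _)).trans (hoc w)).trans
        (Nat.mul_le_mul_right _ hLc)
    have hN₃A : Disjoint N₃ A₁ := by
      rw [Finset.disjoint_left]
      intro v hv
      obtain ⟨w, hw, hv⟩ := Finset.mem_biUnion.1 hv
      exact hbelow w hw v (hQdesc w v hv).1 (hQdesc w v hv).2.1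
    -- The descent occupies only vertices of `Y` in `H`, so of the degree `N + b * τ` inside `H` at
    -- least `b * τ` remains, enough for all tops together.
    have hHA₁ : H ∩ A₁.image φ₁ ⊆ Y := by
      intro y hy
      obtain ⟨hyH, hy⟩ := Finset.mem_inter.1 hy
      obtain ⟨v, hv, rfl⟩ := Finset.mem_image.1 hy
      rcases Finset.mem_union.1 hv with hv | hv
      · rw [hφ₁ v hv] at hyH
        exact absurd (Finset.mem_image_of_mem φ hv) (Finset.disjoint_left.1 hHA hyH)
      · obtain ⟨h1, h2⟩ := D.mem_near.1 hv
        by_cases h3 : D.depth v ≤ D.depth c + ℓ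
        · exact absurd (hnear v (D.mem_near.2 ⟨h1, h3⟩)) (Finset.disjoint_left.1 hHR hyH)
        · exact hlast v (D.mem_descAt.2 ⟨h1.2, by omega⟩)
    have hHcount : ∀ x ∈ H, N₃.card ≤ (G.nbrIn x (H \ A₁.image φ₁)).card := by
      intro x hx
      have h1 := hHdeg x hx
      have h2 := card_nbrIn_le_sdiff_add (G := G) x H (A₁.image φ₁)
      have h3 := Finset.card_le_card hHA₁
      omega
    obtain ⟨φ₂, hφ₂, h₂, hH₂⟩ := h₁.extend (fun _ => H) N₃ hN₃A
      (fun v hv => by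
        obtain ⟨w, hw, hv⟩ := Finset.mem_biUnion.1 hv
        obtain ⟨h1, h2⟩ := D.par_mem_top hv
        refine ⟨h1, h2.imp (fun h3 => ?_) fun h3 => Finset.mem_biUnion.2 ⟨w, hw, h3⟩⟩
        rw [h3]; exact (hLdesc w hw).2.1)
      (fun v hv hv' => by
        refine hHcount _ ?_
        obtain ⟨w, hw, hv⟩ := Finset.mem_biUnion.1 hv
        have h1 : D.par v = w := (D.par_mem_top hv).2.resolve_right fun h3 =>
          Finset.disjoint_left.1 hN₃A (Finset.mem_biUnion.2 ⟨w, hw, h3⟩) hv'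
        rw [h1]
        exact hYH (hlast w hw))
      (fun v hv hv' x hx => hHcount x hx)
    set A₂ := A₁ ∪ N₃ with hA₂
    have hoA₂ : ∀ w ∈ L, o w ∈ A₂ := by
      intro w hw
      by_cases how : o w = w
      · rw [how]; exact Finset.mem_union_left _ (hLdesc w hw).2.1
      · refine Finset.mem_union_right _ (Finset.mem_biUnion.2 ⟨w, hw, ?_⟩)
        simp only [hQ, Finset.mem_erase, Finset.mem_sdiff, D.mem_desc, D.mem_pdesc]
        exact ⟨how, ho w, fun h => h.1 rfl⟩
    have hpo : ∀ w v, v ∈ D.pdesc (o w) → D.IsDesc w v ∧ v ≠ w := by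
      intro w v hv
      have : v ∈ D.pdesc w := by
        rw [D.pdesc_eq_top_union (ho w)]; exact Finset.mem_union_right _ hv
      exact (D.mem_pdesc.1 this).symm
    have hpoA₂ : ∀ w ∈ L, Disjoint (D.pdesc (o w)) A₂ := by
      intro w hw
      rw [Finset.disjoint_left]
      intro v hv hvA
      rcases Finset.mem_union.1 hvA with hvA | hvA
      · exact hbelow w hw v (hpo w v hv).1 (hpo w v hv).2 hvA
      · obtain ⟨w', hw', hv'⟩ := Finset.mem_biUnion.1 hvA
        obtain rfl := hLeq w hw w' hw' v (hpo w v hv).1 (hQdesc w' v hv').1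
        exact (hQdesc w v hv').2.2 hv
    have hA₂R : (A₂.image φ₂ ∩ R).card ≤ (A.image φ ∩ R).card + (C + 1) * b := by
      have h1 : A₂.image φ₂ ∩ R ⊆ (A.image φ ∩ R) ∪ (D.near c ℓ).image φ₂ := by
        intro y hy
        obtain ⟨hy, hyR⟩ := Finset.mem_inter.1 hy
        obtain ⟨v, hv, rfl⟩ := Finset.mem_image.1 hy
        rcases Finset.mem_union.1 hv with hv | hv
        · have hv' := hφ₂ v hv
          rcases Finset.mem_union.1 hv with hv | hv
          · rw [hφ₁ v hv] at hv'
            rw [hv'] at hyR ⊢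
            exact Finset.mem_union_left _ (Finset.mem_inter.2 ⟨Finset.mem_image_of_mem _ hv, hyR⟩)
          · obtain ⟨h1, h2⟩ := D.mem_near.1 hv
            by_cases h3 : D.depth v ≤ D.depth c + ℓ
            · exact Finset.mem_union_right _ (Finset.mem_image_of_mem _ (D.mem_near.2 ⟨h1, h3⟩))
            · rw [hv'] at hyR
              exact absurd hyR (Finset.disjoint_left.1 hHR
                (hYH (hlast v (D.mem_descAt.2 ⟨h1.2, by omega⟩))))
        · exact absurd hyR (Finset.disjoint_left.1 hHR (hH₂ v hv))
      have h2 := D.card_near_le hΔ0 hΔ c ℓ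
      have h3 : ℓ * Δ ^ ℓ ≤ (C + 1) * b :=
        Nat.mul_le_mul (by omega) (Nat.pow_le_pow_right hΔ0 (by omega))
      have h4 : ((D.near c ℓ).image φ₂).card ≤ (D.near c ℓ).card := Finset.card_image_le
      have h5 := (Finset.card_le_card h1).trans (Finset.card_union_le _ _)
      omega
    -- The remaining subtrees are treated one after another, each by the induction hypothesis at its
    -- cut vertex `o w`; below `o w` the sizes have dropped from `(k + 1) * τ` to `k * τ`.
    have hseq : ∀ L' ⊆ L, ∃ φ' : W → V, (∀ v ∈ A₂, φ' v = φ₂ v) ∧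
        IsPartialEmb D G (A₂ ∪ L'.biUnion fun w => D.pdesc (o w)) φ' ∧
        ((A₂ ∪ L'.biUnion fun w => D.pdesc (o w)).image φ' ∩ R).card ≤
          (A₂.image φ₂ ∩ R).card + L'.card * P ^ k := by
      intro L'
      induction L' using Finset.induction_on with
      | empty => intro _; exact ⟨φ₂, fun _ _ => rfl, by simpa using h₂, by simp⟩
      | insert w s hws ihs =>
        intro hsub
        obtain ⟨hwL, hsL⟩ := Finset.insert_subset_iff.1 hsub
        obtain ⟨φ₃, h31, h32, h33⟩ := ihs hsL
        have hsc : s.card + 1 ≤ b := by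
          rw [← Finset.card_insert_of_notMem hws]
          exact (Finset.card_le_card hsub).trans hLc
        have hsc' : (s.card + 1) * P ^ k ≤ b * P ^ k := Nat.mul_le_mul_right _ hsc
        rw [add_mul, one_mul] at hsc'
        obtain ⟨φ₄, h41, h42, h43⟩ := ih _ φ₃ (o w) h32
          (Finset.mem_union_left _ (hoA₂ w hwL))
          (by
            rw [Finset.disjoint_union_right]
            refine ⟨hpoA₂ w hwL, ?_⟩
            rw [Finset.disjoint_biUnion_right]
            intro w' hw'
            rw [Finset.disjoint_left]
            intro v hv hv'
            obtain rfl := hLeq w hwL w' (hsL hw') v (hpo w v hv).1 (hpo w' v hv').1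
            exact hws hw')
          (fun x hx => by
            have h1 := hosz w x hx
            have h2 := hsz w (hLdesc w hwL).1
            rw [add_mul] at h2
            omega)
          (by omega)
        have hun : A₂ ∪ (s.biUnion fun w => D.pdesc (o w)) ∪ D.pdesc (o w) =
            A₂ ∪ ((insert w s).biUnion fun w => D.pdesc (o w)) := by
          rw [Finset.biUnion_insert, Finset.union_assoc,
            Finset.union_comm (s.biUnion fun w => D.pdesc (o w))]
        rw [hun] at h42 h43
        refine ⟨φ₄, fun v hv => ?_, h42, ?_⟩
        · rw [h41 v (Finset.mem_union_left _ hv), h31 v hv]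
        · rw [Finset.card_insert_of_notMem hws, add_mul, one_mul]
          omega
    obtain ⟨φ₃, h31, h32, h33⟩ := hseq L subset_rfl
    have hfin : (A₂ ∪ L.biUnion fun w => D.pdesc (o w)) = A ∪ D.pdesc c := by
      rw [hA₂, hA₁, hN₃, D.pdesc_eq_near_union c (ℓ + 1), Finset.union_assoc, Finset.union_assoc]
      congr 2
      rw [← hL]
      ext v
      simp only [Finset.mem_union, Finset.mem_biUnion]
      constructor
      · rintro (⟨w, hw, hv⟩ | ⟨w, hw, hv⟩) <;> refine ⟨w, hw, ?_⟩ <;>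
          rw [D.pdesc_eq_top_union (ho w)]
        · exact Finset.mem_union_left _ hv
        · exact Finset.mem_union_right _ hv
      · rintro ⟨w, hw, hv⟩
        rw [D.pdesc_eq_top_union (ho w)] at hv
        rcases Finset.mem_union.1 hv with hv | hv
        · exact Or.inl ⟨w, hw, hv⟩
        · exact Or.inr ⟨w, hw, hv⟩
    rw [hfin] at h32 h33
    refine ⟨φ₃, fun v hv => ?_, h32, ?_⟩
    · have hv1 : v ∈ A₁ := Finset.mem_union_left _ hv
      rw [h31 v (Finset.mem_union_left _ hv1), hφ₂ v hv1, hφ₁ v hv]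
    · have := Nat.mul_le_mul_right (P ^ k) hLc
      omega

lemma ParentTree.univ_eq {W : Type*} [Fintype W] (D : ParentTree W) :
    (Finset.univ : Finset W) = {D.root} ∪ D.pdesc D.root := by
  rw [pdesc, desc_root, Finset.singleton_union, Finset.insert_erase (Finset.mem_univ _)]

/-- A tree embeds in a graph whose minimum degree is large. -/
lemma IsPartialEmb.exists_of_min_degree {W V : Type*} [Fintype W] (D : ParentTree W)
    {G : SimpleGraph V} {F : Finset V} (hF : F.Nonempty)
    (h : ∀ v ∈ F, Fintype.card W ≤ (G.nbrIn v F).card) :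
    ∃ φ : W → V, IsPartialEmb D G Finset.univ φ := by
  obtain ⟨x, hx⟩ := hF
  have hcard : (D.pdesc D.root).card + 1 = Fintype.card W := by
    rw [ParentTree.pdesc, ParentTree.desc_root, Finset.card_erase_of_mem (Finset.mem_univ _),
      Finset.card_univ]
    have : 0 < Fintype.card W := Fintype.card_pos_iff.2 ⟨D.root⟩
    omega
  have hcnt : ∀ y ∈ F, (D.pdesc D.root).card ≤
      (G.nbrIn y (F \ ({D.root} : Finset W).image fun _ => x)).card := by
    intro y hy
    have h1 := card_nbrIn_le_sdiff_add (G := G) y F (({D.root} : Finset W).image fun _ => x)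
    have h2 : (F ∩ ({D.root} : Finset W).image fun _ => x).card ≤ 1 :=
      (Finset.card_le_card Finset.inter_subset_right).trans (by simp)
    have := h y hy
    omega
  obtain ⟨φ, -, hφ, -⟩ := (singleton_root (D := D) (G := G) x).extend (fun _ => F)
    (D.pdesc D.root) (by simp [ParentTree.pdesc])
    (fun v hv => by
      obtain ⟨h1, h2⟩ := ParentTree.mem_pdesc.1 hv
      refine ⟨h1, ?_⟩
      by_cases h3 : D.par v = D.root
      · left; simp [h3]
      · right; exact ParentTree.mem_pdesc.2 ⟨h3, ParentTree.isDesc_root _⟩)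
    (fun v _ _ => hcnt _ hx) (fun v _ _ y hy => hcnt y hy)
  rw [← D.univ_eq] at hφ
  exact ⟨φ, hφ⟩

lemma SimpleGraph.IsCutDense.cutDenseOn {V : Type*} [Fintype V] {G : SimpleGraph V} {q : ℝ}
    (h : G.IsCutDense q) : G.CutDenseOn q Finset.univ := by
  intro A B hAB hun
  have := h A B hAB (by convert hun)
  rw [card_interedges_eq_sum] at this
  exact_mod_cast this

lemma SimpleGraph.Subgraph.card_nbrIn_spanningCoe {V : Type*} [Fintype V] {G : SimpleGraph V}
    (R : G.Subgraph) (v : V) :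
    (R.spanningCoe.nbrIn v R.verts.toFinset).card = R.degree v := by
  symm
  refine Fintype.card_of_subtype _ fun y => ?_
  rw [mem_nbrIn, Set.mem_toFinset]
  exact ⟨fun h => h.2, fun h => ⟨R.edge_vert h.symm, h⟩⟩

/-- Large bounded degree trees embed in cut-dense graphs with a large dense regular subgraph. -/
theorem SimpleGraph.IsCutDenseWithRegularSubgraph.exists_emb {L : ℕ} (hL : 1 ≤ L) :
    ∃ d₀ : ℕ, ∀ {W : Type*} [Fintype W] (D : ParentTree W), (∀ v, (D.children v).card ≤ L) →
      d₀ ≤ Fintype.card W → ∀ {V : Type*} [Fintype V] (G : SimpleGraph V) (p q ε : ℝ),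
        1 / (L : ℝ) ≤ p → 1 / (L : ℝ) ≤ q → 1 / (L : ℝ) ≤ ε →
        G.IsCutDenseWithRegularSubgraph p q ((2 + ε) * (Fintype.card W : ℝ)) →
          ∃ φ : W → V, IsPartialEmb D G Finset.univ φ := by
  have hL0 : (0 : ℝ) < L := by exact_mod_cast hL
  have hL1 : (1 : ℝ) ≤ L := by exact_mod_cast hL
  obtain ⟨C, hC⟩ := exists_reservoir (q := 1 / (L : ℝ)) (by positivity)
    (by rw [div_le_one hL0]; exact hL1)
  set b := L ^ (C + 1) with hb
  have hb1 : 1 ≤ b := Nat.one_le_pow _ _ hL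
  -- Chosen so that the reservoir's guarantee `q N / 4`, at `q = 1 / L`, is exactly the `(C + 1) *
  -- b` that a descent needs.
  set N := 4 * L * ((C + 1) * b) with hN
  set E := 8 * L ^ 2 * b with hE
  have hL2 : 1 ≤ L ^ 2 := Nat.one_le_pow _ _ hL
  have hE1 : 1 ≤ E := Nat.mul_pos (by omega) hb1
  -- The recursion has `2 * E` rounds because `d ≤ 2 * E * τ`; the extra `1` allows for the image of
  -- the root in the reservoir.
  set K := 1 + ((C + 2) * b) ^ (2 * E) with hK
  obtain ⟨n₀, hn₀⟩ := hC N K (1 / (4 * (L : ℝ) ^ 2))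
    (Nat.mul_pos (by omega) (Nat.mul_pos (by omega) hb1)) (by positivity)
  refine ⟨max n₀ (E * (N + 1)), ?_⟩
  intro W _ D hΔ hd V _ G p q ε hp hq hε ⟨hcut, R, hRdeg, hRcard⟩
  set d := Fintype.card W with hdef
  have hdn₀ : n₀ ≤ d := (le_max_left _ _).trans hd
  have hdE : E * (N + 1) ≤ d := (le_max_right _ _).trans hd
  have hd1 : 1 ≤ d := Fintype.card_pos_iff.2 ⟨D.root⟩
  have hd1' : (1 : ℝ) ≤ d := by exact_mod_cast hd1
  set n := Fintype.card V with hn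
  set F := R.verts.toFinset with hF
  have hFcard : ((2 : ℝ) + 1 / L) * d ≤ F.card := by
    rw [Set.ncard_eq_toFinset_card'] at hRcard
    refine le_trans ?_ (hRcard.trans (le_of_eq ?_))
    · gcongr
    · congr!
  have hFn : F.card ≤ n := Finset.card_le_univ F
  have hFn' : (F.card : ℝ) ≤ n := by exact_mod_cast hFn
  have hLinv : (0 : ℝ) < 1 / L := by positivity
  have hdF : (d : ℝ) ≤ F.card := by nlinarith
  have hFne : F.Nonempty := Finset.card_pos.1 (by
    have : d ≤ F.card := by exact_mod_cast hdF
    omega)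
  have hreg : ∀ v ∈ F, ((R.spanningCoe.nbrIn v F).card : ℝ) = p * n := by
    intro v hv
    rw [hF, R.card_nbrIn_spanningCoe, ← hRdeg v (by simpa [hF] using hv)]
  have hn0 : (0 : ℝ) < n := lt_of_lt_of_le (by linarith) (hdF.trans hFn')
  have hpn : (n : ℝ) / L ≤ p * n := by
    have := mul_le_mul_of_nonneg_right hp hn0.le
    rw [one_div_mul_eq_div] at this
    exact this
  -- In this case the regular degree is at least `d` and greedy embedding works. Otherwise `n < d *
  -- L`, so quantities linear in `n` and in `d` are comparable.
  by_cases hbig : (d : ℝ) ≤ n / L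
  · refine IsPartialEmb.exists_of_min_degree D hFne fun v hv => ?_
    have h1 : (d : ℝ) ≤ (R.spanningCoe.nbrIn v F).card := by rw [hreg v hv]; linarith
    have h2 : d ≤ (R.spanningCoe.nbrIn v F).card := by exact_mod_cast h1
    exact h2.trans (Finset.card_le_card (nbrIn_subset_of_le R.spanningCoe_le v F))
  push Not at hbig
  rw [div_lt_iff₀ hL0] at hbig
  obtain ⟨S, -, hSc, hS⟩ := hn₀ G Finset.univ (by
    rw [Finset.card_univ]
    have : d ≤ F.card := by exact_mod_cast hdF
    omega) (hcut.cutDenseOn.mono hq)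
  rw [Finset.card_univ, ← hn] at hSc
  set τ := d / E with hτ
  have hτ1 : 1 ≤ τ :=
    (Nat.one_le_div_iff (by omega)).2 ((Nat.le_mul_of_pos_right _ (by omega)).trans hdE)
  have hdτ : d ≤ 2 * E * τ := by
    have h1 := Nat.lt_div_mul_add (a := d) (b := E) (by omega)
    rw [← hτ] at h1
    have := Nat.mul_le_mul_right E hτ1
    nlinarith
  have hτd : E * τ ≤ d := Nat.mul_div_le _ _
  have hSd : 2 * (S.card : ℝ) ≤ d / (2 * L) := by
    have h1 : 1 / (4 * (L : ℝ) ^ 2) * n ≤ d / (4 * L) := by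
      rw [one_div_mul_eq_div, div_le_div_iff₀ (by positivity) (by positivity)]
      nlinarith
    have h2 : (d : ℝ) / (2 * L) = 2 * (d / (4 * L)) := by field_simp; norm_num
    rw [h2]; linarith
  have hH : ∀ X : Finset V, X.card ≤ d → ∃ H : Finset V, Disjoint H S ∧ Disjoint H X ∧
      N ≤ H.card ∧ ∀ v ∈ H, N + L ^ (C + 1) * τ ≤ (G.nbrIn v H).card := by
    intro X hX
    have hX' : (X.card : ℝ) ≤ d := by exact_mod_cast hX
    have hXS : ((X ∪ S).card : ℝ) ≤ X.card + S.card := by exact_mod_cast Finset.card_union_le _ _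
    have h1 := le_sum_card_nbrIn_sdiff (le_trans (by positivity) hpn) hreg (X ∪ S)
    -- Of the surplus `d / L` over `2 d` vertices, the reservoir costs at most half. The surviving
    -- degree sum `d / (2L) * (n / L)` over at most `n` vertices yields the minimum degree `d / (4
    -- L²)` below.
    have h2 : (d : ℝ) / (2 * L) ≤ F.card - 2 * (X ∪ S).card := by
      have h3 : (1 / (L : ℝ)) * d = 2 * (d / (2 * L)) := by field_simp
      nlinarith
    have h3 : (d : ℝ) / (2 * L) * (n / L) ≤
        ∑ v ∈ F \ (X ∪ S), ((R.spanningCoe.nbrIn v (F \ (X ∪ S))).card : ℝ) := by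
      refine le_trans ?_ h1
      have : (0 : ℝ) ≤ d / (2 * L) := by positivity
      gcongr
      exact this.trans h2
    have hne : (F \ (X ∪ S)).Nonempty := by
      rw [Finset.nonempty_iff_ne_empty]
      intro h0
      rw [h0, Finset.sum_empty] at h3
      have : (0 : ℝ) < d / (2 * L) * (n / L) := by positivity
      linarith
    obtain ⟨H, hHF, ⟨v₀, hv₀⟩, hHdeg⟩ := exists_subset_min_degree (G := R.spanningCoe)
      (k := (d : ℝ) / (4 * L ^ 2)) (F \ (X ∪ S)) hne (by
        refine le_trans ?_ h3
        have h4 : ((F \ (X ∪ S)).card : ℝ) ≤ n := by exact_mod_cast Finset.card_le_univ _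
        calc 2 * ((d : ℝ) / (4 * L ^ 2)) * (F \ (X ∪ S)).card
            ≤ 2 * ((d : ℝ) / (4 * L ^ 2)) * n := by gcongr
          _ = (d : ℝ) / (2 * L) * (n / L) := by field_simp; norm_num)
    have hdeg : ∀ v ∈ H, N + b * τ ≤ (G.nbrIn v H).card := by
      intro v hv
      have h5 := (hHdeg v hv).trans (Nat.cast_le.2
        (Finset.card_le_card (nbrIn_subset_of_le R.spanningCoe_le v H)))
      have h6 : ((4 * L ^ 2 * (N + b * τ) : ℕ) : ℝ) ≤ d := by
        have h7 : 4 * L ^ 2 * (N + b * τ) * 2 ≤ 2 * d := by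
          have h8 : 8 * L ^ 2 * N ≤ d := by
            refine le_trans ?_ hdE
            have h9 : 8 * L ^ 2 * N ≤ 8 * L ^ 2 * b * N :=
              Nat.mul_le_mul_right _ (Nat.le_mul_of_pos_right _ hb1)
            exact h9.trans (Nat.mul_le_mul_left _ (by omega))
          have h9 : 8 * L ^ 2 * b * τ ≤ d := hτd
          nlinarith
        exact_mod_cast (by omega : 4 * L ^ 2 * (N + b * τ) ≤ d)
      have h7 : ((N + b * τ : ℕ) : ℝ) ≤ d / (4 * L ^ 2) := by
        rw [le_div_iff₀ (by positivity)]
        push_cast at h6 ⊢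
        linarith
      exact_mod_cast h7.trans h5
    have hdisj : Disjoint H (X ∪ S) := Finset.disjoint_of_subset_left hHF Finset.sdiff_disjoint
    rw [Finset.disjoint_union_right] at hdisj
    refine ⟨H, hdisj.2, hdisj.1, ?_, hdeg⟩
    have := hdeg v₀ hv₀
    have := Finset.card_le_card (nbrIn_subset (G := G) v₀ H)
    omega
  obtain ⟨x, -⟩ := hFne
  obtain ⟨φ, -, hφ, -⟩ := IsPartialEmb.extend_pdesc (G := G) (R := S) hL hΔ hτ1 (N := N) (K := K)
    (C := C) (fun Y hY x => by
      obtain ⟨ℓ, hℓ, Z, h1, h2, h3⟩ := hS Y (Finset.subset_univ _) hY x (Finset.mem_univ _)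
      refine ⟨ℓ, hℓ, Z, h1, fun v hv => ?_, h3⟩
      have h4 := h2 v hv
      have h5 : (1 / (L : ℝ)) * N / 4 = (((C + 1) * b : ℕ) : ℝ) := by
        rw [hN]; push_cast; field_simp
      rw [h5] at h4
      exact_mod_cast h4) hH (2 * E) {D.root} (fun _ => x) D.root
    (IsPartialEmb.singleton_root x) (by simp) (by simp [ParentTree.pdesc])
    (fun y _ => (Finset.card_le_univ _).trans hdτ)
    (by
      have : (({D.root} : Finset W).image (fun _ => x) ∩ S).card ≤ 1 :=
        (Finset.card_le_card Finset.inter_subset_left).trans (by simp)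
      rw [← hb]
      omega)
  rw [← D.univ_eq] at hφ
  exact ⟨φ, hφ⟩

/-! ### Structure (ii): embedding along a tree of pieces -/

/-- The union of the pieces indexed by the descendants of `j`. -/
noncomputable def ParentTree.branch {ι V : Type*} [Fintype ι] (J : ParentTree ι) (P : ι → Finset V)
    (j : ι) : Finset V := (J.desc j).biUnion P

lemma ParentTree.subset_branch {ι V : Type*} [Fintype ι] (J : ParentTree ι) (P : ι → Finset V)
    (j : ι) : P j ⊆ J.branch P j :=
  Finset.subset_biUnion_of_mem P (J.self_mem_desc j)

lemma ParentTree.branch_subset {ι V : Type*} [Fintype ι] (J : ParentTree ι) (P : ι → Finset V)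
    {j k : ι} (h : k ∈ J.children j) : J.branch P k ⊆ J.branch P j := by
  refine Finset.biUnion_subset_biUnion_of_subset_left _ (ParentTree.desc_subset ?_)
  rw [← (ParentTree.mem_children.1 h).2]
  exact ParentTree.isDesc_par k

/-- Embedding everything below `w` in the pieces of a tree of graphs, where each piece below depth
`m` has a reservoir `R` which leads to the vertices `Y` it shares with its children. -/
theorem IsPartialEmb.extend_pdesc_branch {W V ι : Type*} [Fintype W] [Fintype ι]
    {D : ParentTree W} {J : ParentTree ι} {G : SimpleGraph V} {P : ι → Finset V} {Δ C τ m : ℕ}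
    (hΔ0 : 1 ≤ Δ) (hΔ : ∀ v, (D.children v).card ≤ Δ) (hτ : 1 ≤ τ)
    (hdeg : ∀ j, ∀ v ∈ P j, τ + 1 ≤ (G.nbrIn v (P j)).card)
    (hdisj : ∀ j, ∀ k ∈ J.children j, ∀ k' ∈ J.children j, k ≠ k' →
      Disjoint (J.branch P k) (J.branch P k'))
    (hres : ∀ j, J.depth j < m → ∃ (R Y : Finset V) (κ : V → ι), R ⊆ P j ∧ Y ⊆ P j ∧
      (∀ v ∈ P j, τ + 1 + (R.card + Y.card) ≤ (G.nbrIn v (P j)).card) ∧ Set.InjOn κ Y ∧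
      (∀ y ∈ Y, κ y ∈ J.children j ∧ y ∈ P (κ y) ∧ ∀ z ∈ P j, z ∈ J.branch P (κ y) → z = y) ∧
      ∀ x ∈ P j, ∃ ℓ ≤ C, ∃ Z : ℕ → Finset V, x ∈ Z ℓ ∧
        (∀ v ∈ Z 0, (C + 1) * Δ ^ (C + 1) + 1 ≤ (G.nbrIn v Y).card) ∧
        ∀ i < ℓ, ∀ v ∈ Z (i + 1),
          (C + 1) * Δ ^ (C + 1) + 1 + Y.card ≤ (G.nbrIn v (Z i ∩ R)).card)
    (h : ℕ) : ∀ (j : ι) (A : Finset W) (φ : W → V) (w : W), J.depth j + h = m →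
      IsPartialEmb D G A φ → w ∈ A → Disjoint (D.pdesc w) A → φ w ∈ P j →
      (∀ v ∈ A, φ v ∈ J.branch P j → v = w) → (D.desc w).card ≤ (h + 1) * τ →
      ∃ φ' : W → V, (∀ v ∈ A, φ' v = φ v) ∧ IsPartialEmb D G (A ∪ D.pdesc w) φ' ∧
        ∀ v ∈ D.pdesc w, φ' v ∈ J.branch P j := by
  induction h with
  | zero =>
    intro j A φ w _ hφ hw hwA hφw hbr hsz
    have hsz' : (D.pdesc w).card ≤ τ := by
      refine (Finset.card_le_card (D.pdesc_subset_desc w)).trans ?_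
      simpa using hsz
    have hcnt : ∀ x ∈ P j, (D.pdesc w).card ≤ (G.nbrIn x (P j \ A.image φ)).card := by
      intro x hx
      have h1 := card_nbrIn_le_sdiff_add (G := G) x (P j) (A.image φ)
      have h2 : (P j ∩ A.image φ).card ≤ ({φ w} : Finset V).card := by
        refine Finset.card_le_card fun y hy => ?_
        obtain ⟨hy1, hy2⟩ := Finset.mem_inter.1 hy
        obtain ⟨v, hv, rfl⟩ := Finset.mem_image.1 hy2
        rw [hbr v hv (J.subset_branch P j hy1)]
        exact Finset.mem_singleton_self _
      rw [Finset.card_singleton] at h2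
      have := hdeg j x hx
      omega
    have hpar : ∀ v ∈ D.pdesc w, v ≠ D.root ∧ (D.par v = w ∨ D.par v ∈ D.pdesc w) := by
      intro v hv
      obtain ⟨h1, h2⟩ := D.mem_pdesc.1 hv
      obtain ⟨h3, h4⟩ := h2.par_of_ne h1
      exact ⟨h3, or_iff_not_imp_left.2 fun h5 => D.mem_pdesc.2 ⟨h5, h4⟩⟩
    obtain ⟨φ', h1, h2, h3⟩ := hφ.extend (fun _ => P j) (D.pdesc w) hwA
      (fun v hv => ⟨(hpar v hv).1, (hpar v hv).2.imp (fun h => by rwa [h]) id⟩)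
      (fun v hv hv' => by
        have := (hpar v hv).2.resolve_right fun h => Finset.disjoint_left.1 hwA h hv'
        rw [this]
        exact hcnt _ hφw)
      (fun v _ _ x hx => hcnt x hx)
    exact ⟨φ', h1, h2, fun v hv => J.subset_branch P j (h3 v hv)⟩
  | succ h ih =>
    intro j A φ w hjm hφ hw hwA hφw hbr hsz
    obtain ⟨R, Y, κ, hRP, hYP, hdeg', hκ, hκY, hZ⟩ := hres j (by omega)
    obtain ⟨o, ho, hoc, hosz⟩ := D.exists_top w hτ
    set Q := (D.desc w \ D.pdesc o).erase w with hQ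
    have hQc : Q.card ≤ τ := (Finset.card_le_card (Finset.erase_subset _ _)).trans hoc
    have hpw : D.pdesc w = Q ∪ D.pdesc o := D.pdesc_eq_top_union ho
    have hQA : Disjoint Q A := hwA.mono_left (by rw [hpw]; exact Finset.subset_union_left)
    have himg : ∀ y ∈ P j, y ∈ A.image φ → y = φ w := by
      intro y hy1 hy2
      obtain ⟨v, hv, rfl⟩ := Finset.mem_image.1 hy2
      rw [hbr v hv (J.subset_branch P j hy1)]
    have hcnt : ∀ x ∈ P j, Q.card ≤ (G.nbrIn x ((P j \ (R ∪ Y)) \ A.image φ)).card := by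
      intro x hx
      have h1 := card_nbrIn_le_sdiff_add (G := G) x (P j) (R ∪ Y ∪ A.image φ)
      have h2 : (P j ∩ (R ∪ Y ∪ A.image φ)).card ≤ (R.card + Y.card) + 1 := by
        have : P j ∩ (R ∪ Y ∪ A.image φ) ⊆ (R ∪ Y) ∪ {φ w} := by
          intro y hy
          obtain ⟨hy1, hy2⟩ := Finset.mem_inter.1 hy
          rcases Finset.mem_union.1 hy2 with hy2 | hy2
          · exact Finset.mem_union_left _ hy2
          · exact Finset.mem_union_right _ (Finset.mem_singleton.2 (himg y hy1 hy2))
        refine (Finset.card_le_card this).trans ((Finset.card_union_le _ _).trans ?_)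
        exact Nat.add_le_add (Finset.card_union_le _ _) (by simp)
      rw [show P j \ (R ∪ Y ∪ A.image φ) = (P j \ (R ∪ Y)) \ A.image φ from
        sdiff_sdiff_left.symm] at h1
      have := hdeg' x hx
      omega
    -- The top avoids `R` and `Y`, so afterwards `φ w` is the only image that can lie in them; this
    -- accounts for the `+ 1` in the degree conditions.
    obtain ⟨φ₁, hφ₁, h₁, hQ₁⟩ := hφ.extend (fun _ => P j \ (R ∪ Y)) Q hQA
      (fun v hv => ⟨(D.par_mem_top hv).1, (D.par_mem_top hv).2.imp (fun h => by rwa [h]) id⟩)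
      (fun v hv hv' => by
        have := (D.par_mem_top hv).2.resolve_right fun h => Finset.disjoint_left.1 hQA h hv'
        rw [this]
        exact hcnt _ hφw)
      (fun v _ _ x hx => hcnt x (Finset.mem_sdiff.1 hx).1)
    set A₁ := A ∪ Q with hA₁
    have hQP : ∀ v ∈ Q, φ₁ v ∈ P j := fun v hv => (Finset.mem_sdiff.1 (hQ₁ v hv)).1
    have hoA : o = w ∨ o ∈ Q := by
      refine or_iff_not_imp_left.2 fun h => ?_
      simp only [hQ, Finset.mem_erase, Finset.mem_sdiff, D.mem_desc, D.mem_pdesc]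
      exact ⟨h, ho, fun h => h.1 rfl⟩
    have hoA₁ : o ∈ A₁ := by
      rcases hoA with h | h
      · rw [h]; exact Finset.mem_union_left _ hw
      · exact Finset.mem_union_right _ h
    have hoP : φ₁ o ∈ P j := by
      rcases hoA with h | h
      · rw [h, hφ₁ w hw]; exact hφw
      · exact hQP o h
    have hoA₁' : Disjoint (D.pdesc o) A₁ := by
      rw [Finset.disjoint_union_right]
      refine ⟨hwA.mono_left (by rw [hpw]; exact Finset.subset_union_right), ?_⟩
      rw [Finset.disjoint_left]
      intro v hv hv'
      exact (Finset.mem_sdiff.1 (Finset.mem_of_mem_erase hv')).2 hv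
    have himg₁ : ∀ y ∈ R ∪ Y, y ∈ A₁.image φ₁ → y = φ w := by
      intro y hy1 hy2
      obtain ⟨v, hv, rfl⟩ := Finset.mem_image.1 hy2
      rcases Finset.mem_union.1 hv with hv | hv
      · rw [hφ₁ v hv] at hy1 ⊢
        exact himg _ (Finset.union_subset hRP hYP hy1) (Finset.mem_image_of_mem _ hv)
      · exact absurd hy1 (Finset.mem_sdiff.1 (hQ₁ v hv)).2
    obtain ⟨ℓ, hℓ, Z, hoZ, hZ0, hZs⟩ := hZ _ hoP
    obtain ⟨φ₂, hφ₂, h₂, hnear, hlast⟩ := h₁.descend hoA₁ hoA₁' hΔ0 hΔ hℓ (R \ Y) Y Z hoZ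
      (fun v hv => by
        have h1 := hZ0 v hv
        have h2 := card_nbrIn_le_sdiff_add (G := G) v Y (A₁.image φ₁)
        have h3 : (Y ∩ A₁.image φ₁).card ≤ ({φ w} : Finset V).card := by
          refine Finset.card_le_card fun y hy => Finset.mem_singleton.2 ?_
          obtain ⟨hy1, hy2⟩ := Finset.mem_inter.1 hy
          exact himg₁ y (Finset.mem_union_right _ hy1) hy2
        rw [Finset.card_singleton] at h3
        omega)
      (fun i hi v hv => by
        have h1 := hZs i hi v hv
        have h2 := card_nbrIn_le_sdiff_add (G := G) v (Z i ∩ R) (Y ∪ A₁.image φ₁)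
        have h3 : (Z i ∩ R ∩ (Y ∪ A₁.image φ₁)).card ≤ Y.card + 1 := by
          have : Z i ∩ R ∩ (Y ∪ A₁.image φ₁) ⊆ Y ∪ {φ w} := by
            intro y hy
            obtain ⟨hy1, hy2⟩ := Finset.mem_inter.1 hy
            rcases Finset.mem_union.1 hy2 with hy2 | hy2
            · exact Finset.mem_union_left _ hy2
            · exact Finset.mem_union_right _ (Finset.mem_singleton.2
                (himg₁ y (Finset.mem_union_left _ (Finset.mem_inter.1 hy1).2) hy2))
          exact (Finset.card_le_card this).trans
            ((Finset.card_union_le _ _).trans (Nat.add_le_add le_rfl (by simp)))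
        rw [show (Z i ∩ R) \ (Y ∪ A₁.image φ₁) = (Z i ∩ (R \ Y)) \ A₁.image φ₁ by
          rw [← Finset.inter_sdiff_assoc]; exact sdiff_sdiff_left.symm] at h2
        omega)
    set A₂ := A₁ ∪ D.near o (ℓ + 1) with hA₂
    set L := D.descAt o (ℓ + 1) with hL
    have hLdesc : ∀ x ∈ L, x ∈ D.pdesc o ∧ x ∈ A₂ ∧ D.IsDesc o x ∧
        D.depth x = D.depth o + (ℓ + 1) := by
      intro x hx
      obtain ⟨h1, h2⟩ := D.mem_descAt.1 hx
      have h3 : x ≠ o := by rintro rfl; omega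
      exact ⟨D.mem_pdesc.2 ⟨h3, h1⟩,
        Finset.mem_union_right _ (D.mem_near.2 ⟨⟨h3, h1⟩, h2.le⟩), h1, h2⟩
    have hnearP : ∀ v ∈ D.near o (ℓ + 1), φ₂ v ∈ P j := by
      intro v hv
      obtain ⟨h1, h2⟩ := D.mem_near.1 hv
      by_cases h3 : D.depth v ≤ D.depth o + ℓ
      · exact hRP (Finset.mem_sdiff.1 (hnear v (D.mem_near.2 ⟨h1, h3⟩))).1
      · exact hYP (hlast v (D.mem_descAt.2 ⟨h1.2, by omega⟩))
    have hA₂P : ∀ v ∈ A₂, φ₂ v ∈ J.branch P j → φ₂ v ∈ P j := by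
      intro v hv hvb
      rcases Finset.mem_union.1 hv with hv | hv
      · rw [hφ₂ v hv] at hvb ⊢
        rcases Finset.mem_union.1 hv with hv | hv
        · rw [hφ₁ v hv] at hvb ⊢
          rwa [hbr v hv hvb]
        · exact hQP v hv
      · exact hnearP v hv
    -- Restores the invariant for the child: its branch meets `P j` only in the shared vertex, so
    -- `x` is the only vertex of `A₂` mapped into it.
    have hxinv : ∀ x ∈ L, ∀ v ∈ A₂, φ₂ v ∈ J.branch P (κ (φ₂ x)) → v = x := by
      intro x hx v hv hvb
      obtain ⟨h1, -, h3⟩ := hκY _ (hlast x hx)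
      exact h₂.inj hv (hLdesc x hx).2.1 (h3 _ (hA₂P v hv (J.branch_subset P h1 hvb)) hvb)
    have hLA₂ : ∀ x ∈ L, Disjoint (D.pdesc x) A₂ := by
      intro x hx
      obtain ⟨h1, h2, h3, h4⟩ := hLdesc x hx
      rw [Finset.disjoint_left]
      intro v hv hvA
      obtain ⟨h5, h6⟩ := D.mem_pdesc.1 hv
      have h7 := h6.depth_lt h5
      rcases Finset.mem_union.1 hvA with hvA | hvA
      · exact Finset.disjoint_left.1 hoA₁'
          (D.mem_pdesc.2 ⟨by rintro rfl; omega, h3.trans h6⟩) hvA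
      · have := (D.mem_near.1 hvA).2
        omega
    have hLeq : ∀ x ∈ L, ∀ x' ∈ L, ∀ v, v ∈ D.pdesc x → v ∈ D.pdesc x' → x = x' :=
      fun x hx x' hx' v hv hv' =>
        (D.mem_pdesc.1 hv).2.eq_of_depth_eq (D.mem_pdesc.1 hv').2
          ((hLdesc x hx).2.2.2.trans (hLdesc x' hx').2.2.2.symm)
    have hseq : ∀ L' ⊆ L, ∃ φ' : W → V, (∀ v ∈ A₂, φ' v = φ₂ v) ∧
        IsPartialEmb D G (A₂ ∪ L'.biUnion D.pdesc) φ' ∧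
        ∀ x ∈ L', ∀ v ∈ D.pdesc x, φ' v ∈ J.branch P (κ (φ₂ x)) := by
      intro L'
      induction L' using Finset.induction_on with
      | empty => intro _; exact ⟨φ₂, fun _ _ => rfl, by simpa using h₂, by simp⟩
      | insert x s hxs ihs =>
        intro hsub
        obtain ⟨hxL, hsL⟩ := Finset.insert_subset_iff.1 hsub
        obtain ⟨φ₃, h31, h32, h33⟩ := ihs hsL
        obtain ⟨hx1, hx2, -⟩ := hκY _ (hlast x hxL)
        have hdj : Disjoint (D.pdesc x) (A₂ ∪ s.biUnion D.pdesc) := by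
          rw [Finset.disjoint_union_right]
          refine ⟨hLA₂ x hxL, ?_⟩
          rw [Finset.disjoint_biUnion_right]
          intro x' hx'
          rw [Finset.disjoint_left]
          intro v hv hv'
          obtain rfl := hLeq x hxL x' (hsL hx') v hv hv'
          exact hxs hx'
        obtain ⟨φ₄, h41, h42, h43⟩ := ih (κ (φ₂ x)) _ φ₃ x
          (by
            obtain ⟨h1, h2⟩ := J.mem_children.1 hx1
            have := J.depth_par _ h1
            rw [h2] at this
            omega)
          h32 (Finset.mem_union_left _ (hLdesc x hxL).2.1) hdj
          (by rw [h31 x (hLdesc x hxL).2.1]; exact hx2)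
          (by
            intro v hv hvb
            rcases Finset.mem_union.1 hv with hv | hv
            · rw [h31 v hv] at hvb
              exact hxinv x hxL v hv hvb
            · obtain ⟨x', hx', hv⟩ := Finset.mem_biUnion.1 hv
              have hne : x' ≠ x := by rintro rfl; exact hxs hx'
              have hne' : κ (φ₂ x') ≠ κ (φ₂ x) := fun he =>
                hne (h₂.inj (hLdesc x' (hsL hx')).2.1 (hLdesc x hxL).2.1
                  (hκ (hlast x' (hsL hx')) (hlast x hxL) he))
              exact absurd hvb (Finset.disjoint_left.1
                (hdisj j _ (hκY _ (hlast x' (hsL hx'))).1 _ hx1 hne') (h33 x' hx' v hv)))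
          (by
            have h1 := hosz x (hLdesc x hxL).1
            rw [add_mul, one_mul] at hsz
            omega)
        have hun : A₂ ∪ s.biUnion D.pdesc ∪ D.pdesc x = A₂ ∪ (insert x s).biUnion D.pdesc := by
          rw [Finset.biUnion_insert, Finset.union_assoc, Finset.union_comm (s.biUnion D.pdesc)]
        rw [hun] at h42
        refine ⟨φ₄, fun v hv => ?_, h42, fun x' hx' v hv => ?_⟩
        · rw [h41 v (Finset.mem_union_left _ hv), h31 v hv]
        · rcases Finset.mem_insert.1 hx' with rfl | hx'
          · exact h43 v hv
          · rw [h41 v (Finset.mem_union_right _ (Finset.mem_biUnion.2 ⟨x', hx', hv⟩))]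
            exact h33 x' hx' v hv
    obtain ⟨φ₃, h31, h32, h33⟩ := hseq L subset_rfl
    have hpo : D.pdesc o = D.near o (ℓ + 1) ∪ L.biUnion D.pdesc :=
      D.pdesc_eq_near_union o (ℓ + 1)
    have hfin : A₂ ∪ L.biUnion D.pdesc = A ∪ D.pdesc w := by
      rw [hpw, hpo, hA₂, hA₁]
      simp only [Finset.union_assoc]
    rw [hfin] at h32
    refine ⟨φ₃, fun v hv => ?_, h32, fun v hv => ?_⟩
    · have hv1 : v ∈ A₁ := Finset.mem_union_left _ hv
      rw [h31 v (Finset.mem_union_left _ hv1), hφ₂ v hv1, hφ₁ v hv]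
    · rw [hpw, hpo] at hv
      rcases Finset.mem_union.1 hv with hv | hv
      · have hv1 : v ∈ A₁ := Finset.mem_union_right _ hv
        rw [h31 v (Finset.mem_union_left _ hv1), hφ₂ v hv1]
        exact J.subset_branch P j (hQP v hv)
      · rcases Finset.mem_union.1 hv with hv | hv
        · rw [h31 v (Finset.mem_union_right _ hv)]
          exact J.subset_branch P j (hnearP v hv)
        · obtain ⟨x, hx, hv⟩ := Finset.mem_biUnion.1 hv
          exact J.branch_subset P (hκY _ (hlast x hx)).1 (h33 x hx v hv)

/-- Passing from the piece to the host graph on the same vertices can only add edges across a cut.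
-/
lemma SimpleGraph.Subgraph.cutDenseOn_verts {V : Type*} [Fintype V] {G : SimpleGraph V}
    {H : G.Subgraph} {q : ℝ} (h : H.coe.IsCutDense q) : G.CutDenseOn q H.verts.toFinset := by
  intro A B hAB hun
  have hmap : ∀ X : Finset V, X ⊆ H.verts.toFinset →
      (X.subtype (· ∈ H.verts)).map (Function.Embedding.subtype _) = X := fun X hX =>
    Finset.subtype_map_of_mem fun x hx => Set.mem_toFinset.1 (hX hx)
  have hA := hmap A (hun ▸ Finset.subset_union_left)
  have hB := hmap B (hun ▸ Finset.subset_union_right)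
  set A' := A.subtype (· ∈ H.verts)
  set B' := B.subtype (· ∈ H.verts)
  have hAB' : Disjoint A' B' := by
    rw [← hA, ← hB] at hAB
    exact (Finset.disjoint_map _).1 hAB
  have hun' : A' ∪ B' = Finset.univ := by
    ext x
    simp only [Finset.mem_union, A', B', Finset.mem_subtype, Finset.mem_univ, iff_true]
    rw [← Finset.mem_union, hun, Set.mem_toFinset]
    exact x.2
  have key := h A' B' hAB' (by convert hun')
  rw [card_interedges_eq_sum, ← Finset.card_map (s := A') (Function.Embedding.subtype _),
    ← Finset.card_map (s := B') (Function.Embedding.subtype _), hA, hB] at key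
  refine key.trans ?_
  rw [← hA, Finset.sum_map]
  push_cast
  refine Finset.sum_le_sum fun v hv => ?_
  rw [← hB]
  have hsub : (H.coe.nbrIn v B').map (Function.Embedding.subtype _) ⊆
      G.nbrIn (Function.Embedding.subtype _ v) (B'.map (Function.Embedding.subtype _)) := by
    intro y hy
    obtain ⟨z, hz, rfl⟩ := Finset.mem_map.1 hy
    rw [mem_nbrIn] at hz
    exact mem_nbrIn.2 ⟨Finset.mem_map_of_mem _ hz.1, H.adj_sub hz.2⟩
  have := Finset.card_le_card hsub
  rw [Finset.card_map] at this
  exact_mod_cast this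

/-- Pieces that are arranged along a rooted tree: the branches at two children of `j` are disjoint,
and a branch at a child of `j` meets the piece of `j` only in the piece of that child. -/
lemma ParentTree.branch_inter {ι V : Type*} [Fintype ι] {J : ParentTree ι} {P : ι → Finset V}
    (hP : ∀ i j, i ≠ j → ¬ (i ≠ J.root ∧ J.par i = j) → ¬ (j ≠ J.root ∧ J.par j = i) →
      Disjoint (P i) (P j)) {j k : ι} (hk : k ∈ J.children j) :
    (∀ x ∈ P j, x ∈ J.branch P k → x ∈ P k) ∧
      ∀ k' ∈ J.children j, k ≠ k' → Disjoint (J.branch P k) (J.branch P k') := by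
  obtain ⟨hk1, hk2⟩ := ParentTree.mem_children.1 hk
  have hkd := J.depth_par k hk1
  rw [hk2] at hkd
  constructor
  · intro x hxj hxk
    obtain ⟨m, hm, hxm⟩ := Finset.mem_biUnion.1 hxk
    rw [ParentTree.mem_desc] at hm
    have hmd := hm.depth_le
    by_contra hne
    have hmk : m ≠ k := by rintro rfl; exact hne hxm
    have hmd' := hm.depth_lt hmk
    refine Finset.disjoint_left.1 (hP j m ?_ ?_ ?_) hxj hxm
    · rintro rfl; omega
    · rintro ⟨h1, h2⟩
      have := J.depth_par j h1
      rw [h2] at this; omega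
    · rintro ⟨h1, h2⟩
      have := J.depth_par m h1
      rw [h2] at this; omega
  · intro k' hk' hne
    obtain ⟨hk1', hk2'⟩ := ParentTree.mem_children.1 hk'
    have hkd' := J.depth_par k' hk1'
    rw [hk2'] at hkd'
    have hdd := ParentTree.desc_disjoint_of_depth_eq hne (hkd.symm.trans hkd')
    -- No edge of the index tree joins the two branches: the parent of `m'` is either `j`, too
    -- shallow to lie below `k`, or still below `k'`.
    have haux : ∀ k k' m m', k ≠ k' → J.par k' = j → J.depth k = J.depth j + 1 →
        J.depth k' = J.depth j + 1 → Disjoint (J.desc k) (J.desc k') → J.IsDesc k m →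
        J.IsDesc k' m' → J.par m' ≠ m := by
      intro k k' m m' hkk hk2 hkd hkd' hdd hm hm' hmm
      by_cases h2 : m' = k'
      · rw [h2, hk2] at hmm
        have := hm.depth_le
        rw [← hmm] at this; omega
      · have h3 := (hm'.par_of_ne h2).2
        rw [hmm] at h3
        exact Finset.disjoint_left.1 hdd (ParentTree.mem_desc.2 hm) (ParentTree.mem_desc.2 h3)
    rw [Finset.disjoint_left]
    intro x hx hx'
    obtain ⟨m, hm, hxm⟩ := Finset.mem_biUnion.1 hx
    obtain ⟨m', hm', hxm'⟩ := Finset.mem_biUnion.1 hx'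
    refine Finset.disjoint_left.1 (hP m m' ?_ ?_ ?_) hxm hxm'
    · rintro rfl
      exact Finset.disjoint_left.1 hdd hm hm'
    · rintro ⟨-, h1⟩
      exact haux k' k m' m hne.symm hk2 hkd'.symm hkd.symm hdd.symm (ParentTree.mem_desc.1 hm')
        (ParentTree.mem_desc.1 hm) h1
    · rintro ⟨-, h1⟩
      exact haux k k' m m' hne hk2' hkd.symm hkd'.symm hdd (ParentTree.mem_desc.1 hm)
        (ParentTree.mem_desc.1 hm') h1

/-- Large bounded degree trees embed in trees of cut-dense graphs. -/
theorem SimpleGraph.IsAryTreeOfCutDense.exists_emb {b : ℕ} (hb : 1 ≤ b) :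
    ∃ L₀ : ℕ, ∀ L : ℕ, L₀ ≤ L → ∃ d₀ : ℕ, ∀ {W : Type*} [Fintype W] (D : ParentTree W),
      (∀ v, (D.children v).card ≤ b) → d₀ ≤ Fintype.card W →
      ∀ {V : Type*} [Fintype V] (G : SimpleGraph V) (q : ℝ), 1 / (b : ℝ) ≤ q →
        G.IsAryTreeOfCutDense q L (16 * (Fintype.card W : ℝ) / (q * (L : ℝ))) →
          ∃ φ : W → V, IsPartialEmb D G Finset.univ φ := by
  have hb0 : (0 : ℝ) < b := by exact_mod_cast hb
  obtain ⟨C, hC⟩ := exists_reservoir (q := 1 / (b : ℝ)) (by positivity)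
    (by rw [div_le_one hb0]; exact_mod_cast hb)
  set D₀ := (C + 1) * b ^ (C + 1) with hD₀
  -- A non-leaf piece has at least `N = L - 1` children, its degree less a possible parent. This
  -- bound on `L` gives `N / (4 b) ≥ D₀ + 1`, as a descent into `Y` requires when one vertex of `Y`
  -- may be occupied.
  refine ⟨4 * b * (D₀ + 1) + 3, fun L hL => ?_⟩
  set N := L - 1 with hN
  have hN1 : 4 * b * (D₀ + 1) ≤ N := by omega
  have hNL : N + 1 = L := by omega
  obtain ⟨n₀, hn₀⟩ := hC N (D₀ + 1 + N) (1 / (4 * (b : ℝ))) (by omega) (by positivity)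
  refine ⟨L * (n₀ + L + 2), ?_⟩
  rintro W _ D hΔ hd V _ G q hq ⟨t, H, S, r, u, -, hH, ⟨hST, hSdeg, hSleaf⟩, huinj, huadj, hunadj⟩
  set d := Fintype.card W with hdef
  have hL0 : (0 : ℝ) < L := by exact_mod_cast (by omega : 0 < L)
  have hq0 : 0 < q := lt_of_lt_of_le (by positivity) hq
  obtain ⟨J, hJr, hJd, hJadj, hJadj'⟩ := hST.exists_parentTree r
  set P : Fin t → Finset V := fun i => (H i).verts.toFinset with hP
  have hchadj : ∀ j k, k ∈ J.children j → S.Adj j k := by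
    intro j k hk
    obtain ⟨h1, h2⟩ := J.mem_children.1 hk
    rw [← h2]
    exact hJadj k h1
  have hPP : ∀ j k, S.Adj j k → ∀ x, x ∈ P j → x ∈ P k → x = u s(j, k) := by
    intro j k hjk x hj hk
    have h1 : x ∈ (H j).verts ∩ (H k).verts := ⟨Set.mem_toFinset.1 hj, Set.mem_toFinset.1 hk⟩
    rw [huadj j k hjk] at h1
    exact h1
  have huP : ∀ j k, S.Adj j k → u s(j, k) ∈ P j ∧ u s(j, k) ∈ P k := by
    intro j k hjk
    have h1 : u s(j, k) ∈ (H j).verts ∩ (H k).verts := by rw [huadj j k hjk]; rfl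
    exact ⟨Set.mem_toFinset.2 h1.1, Set.mem_toFinset.2 h1.2⟩
  have hPdisj : ∀ i j, i ≠ j → ¬ (i ≠ J.root ∧ J.par i = j) → ¬ (j ≠ J.root ∧ J.par j = i) →
      Disjoint (P i) (P j) := by
    intro i j hij h1 h2
    have h3 : ¬ S.Adj i j := fun h => (hJadj' i j h).elim h1 h2
    rw [Finset.disjoint_left]
    intro x hi hj
    have h4 : x ∈ (H i).verts ∩ (H j).verts := ⟨Set.mem_toFinset.1 hi, Set.mem_toFinset.1 hj⟩
    rw [hunadj i j hij h3] at h4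
    exact h4
  have hchild : ∀ j, J.depth j < L → N ≤ (J.children j).card := by
    intro j hj
    have h1 : S.degree j = L := by
      refine hSdeg j fun h => ?_
      have := hSleaf j h
      rw [hJd] at hj
      omega
    have h2 : S.neighborFinset j ⊆ insert (J.par j) (J.children j) := by
      intro k hk
      rw [mem_neighborFinset] at hk
      rcases hJadj' j k hk with ⟨-, h⟩ | ⟨h, h'⟩
      · exact Finset.mem_insert.2 (Or.inl h.symm)
      · exact Finset.mem_insert_of_mem (J.mem_children.2 ⟨h, h'⟩)
    have h3 := (Finset.card_le_card h2).trans (Finset.card_insert_le _ _)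
    rw [card_neighborFinset_eq_degree, h1] at h3
    omega
  have huinj' : ∀ j, Set.InjOn (fun k => u s(j, k)) (J.children j) := by
    intro j k hk k' hk' he
    have := huinj (S.mem_edgeSet.2 (hchadj j k hk)) (S.mem_edgeSet.2 (hchadj j k' hk')) he
    exact Sym2.congr_right.1 this
  have hcut : ∀ j, G.CutDenseOn q (P j) := fun j => Subgraph.cutDenseOn_verts (hH j).2
  have hrd : J.depth r = 0 := by rw [← hJr]; exact J.depth_root
  have hPr : N ≤ (P r).card := by
    have h1 := hchild r (by omega)
    rw [← Finset.card_image_of_injOn (huinj' r)] at h1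
    refine h1.trans (Finset.card_le_card fun y hy => ?_)
    obtain ⟨k, hk, rfl⟩ := Finset.mem_image.1 hy
    exact (huP r k (hchadj r k hk)).1
  have hN2 : 2 ≤ N := by omega
  obtain ⟨x₀, hx₀⟩ : (P r).Nonempty := Finset.card_pos.1 (by omega)
  have hq1 : q ≤ 1 := by
    have h1 := (hcut r).le_card_nbrIn hx₀
    have h2 : G.nbrIn x₀ (P r) ⊆ (P r).erase x₀ := by
      intro y hy
      rw [mem_nbrIn] at hy
      exact Finset.mem_erase.2 ⟨hy.2.ne', hy.1⟩
    have h3 := Finset.card_le_card h2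
    rw [Finset.card_erase_of_mem hx₀] at h3
    have h4 : ((G.nbrIn x₀ (P r)).card : ℝ) ≤ (P r).card - 1 := by
      rw [le_sub_iff_add_le]
      exact_mod_cast (by omega : (G.nbrIn x₀ (P r)).card + 1 ≤ (P r).card)
    have h5 : (2 : ℝ) ≤ (P r).card := by exact_mod_cast hN2.trans hPr
    by_contra h6
    push Not at h6
    nlinarith
  have hd' : ((n₀ : ℝ) + L + 2) ≤ d / L := by
    rw [le_div_iff₀ hL0]
    have : ((L * (n₀ + L + 2) : ℕ) : ℝ) ≤ d := by exact_mod_cast hd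
    push_cast at this
    linarith
  have hqm : ∀ j, 16 * ((d : ℝ) / L) ≤ q * (P j).card := by
    intro j
    have h1 := (hH j).1
    rw [Set.ncard_eq_toFinset_card', div_le_iff₀ (by positivity)] at h1
    rw [← mul_div_assoc, div_le_iff₀ hL0]
    refine h1.trans (le_of_eq ?_)
    simp only [hP]
    ring
  have hPn₀ : ∀ j, n₀ ≤ (P j).card := by
    intro j
    have h1 := hqm j
    have h2 : q * (P j).card ≤ (P j).card := mul_le_of_le_one_left (by positivity) hq1
    have h3 : (0 : ℝ) ≤ n₀ := by positivity
    have : (n₀ : ℝ) ≤ (P j).card := by linarith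
    exact_mod_cast this
  -- The floor plus one, so that the `L + 1` levels of pieces absorb `(L + 1) * τ ≥ d` vertices.
  set τ := d / L + 1 with hτ
  have hτL : (τ : ℝ) ≤ d / L + 1 := by
    rw [hτ]; push_cast
    gcongr
    exact Nat.cast_div_le
  have hdτ : d ≤ (L + 1) * τ := by
    have h1 := Nat.lt_mul_div_succ d (by omega : 0 < L)
    rw [← hτ] at h1
    rw [add_mul]
    omega
  have hdegP : ∀ j, ∀ v ∈ P j, ∀ c : ℕ, (c : ℝ) ≤ (1 / (4 * (b : ℝ))) * (P j).card + N →
      τ + 1 + c ≤ (G.nbrIn v (P j)).card := by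
    intro j v hv c hc
    have h1 := (hcut j).le_card_nbrIn hv
    have h2 := hqm j
    have h3 : (1 / (4 * (b : ℝ))) * (P j).card ≤ q * (P j).card / 4 := by
      have : (1 / (4 * (b : ℝ))) = 1 / b / 4 := by ring
      rw [this, div_mul_eq_mul_div]
      gcongr
    have h4 : (N : ℝ) + 1 = L := by exact_mod_cast hNL
    have h5 : (0 : ℝ) ≤ n₀ := by positivity
    have h6 : ((τ + 1 + c : ℕ) : ℝ) ≤ (G.nbrIn v (P j)).card := by
      push_cast
      linarith
    exact_mod_cast h6
  obtain ⟨φ, -, hφ, -⟩ := IsPartialEmb.extend_pdesc_branch (D := D) (J := J) (G := G) (P := P)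
    (C := C) (τ := τ) (m := L) hb hΔ (Nat.le_add_left 1 _) (fun j v hv => hdegP j v hv 0 (by
      push_cast; positivity))
    (fun j k hk => (J.branch_inter hPdisj hk).2)
    (fun j hj => by
      obtain ⟨R, hRP, hRc, hR⟩ := hn₀ G (P j) (hPn₀ j) ((hcut j).mono hq)
      obtain ⟨I, hIJ, hIN⟩ := Finset.exists_subset_card_eq (hchild j hj)
      have hinj : Set.InjOn (fun k => u s(j, k)) I := (huinj' j).mono hIJ
      set Y := I.image fun k => u s(j, k) with hY
      have hYc : Y.card = N := by rw [hY, Finset.card_image_of_injOn hinj, hIN]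
      have hYP : Y ⊆ P j := by
        intro y hy
        obtain ⟨k, hk, rfl⟩ := Finset.mem_image.1 hy
        exact (huP j k (hchadj j k (hIJ hk))).1
      have : Nonempty (Fin t) := ⟨r⟩
      have hκ : ∀ y, ∃ k, y ∈ Y → k ∈ J.children j ∧ u s(j, k) = y := by
        intro y
        by_cases hy : y ∈ Y
        · obtain ⟨k, hk, rfl⟩ := Finset.mem_image.1 hy
          exact ⟨k, fun _ => ⟨hIJ hk, rfl⟩⟩
        · exact ⟨r, fun h => absurd h hy⟩
      choose κ hκ using hκ
      refine ⟨R, Y, κ, hRP, hYP, fun v hv => hdegP j v hv _ ?_, ?_, ?_, fun x hx => ?_⟩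
      · push_cast
        rw [hYc]
        linarith
      · intro y hy y' hy' he
        rw [← (hκ y hy).2, ← (hκ y' hy').2, he]
      · intro y hy
        obtain ⟨h1, h2⟩ := hκ y hy
        have h3 := hchadj j _ h1
        refine ⟨h1, ?_, fun z hz hzb => ?_⟩
        · have := (huP j _ h3).2
          rwa [h2] at this
        · rw [← h2]
          exact hPP j _ h3 z hz ((J.branch_inter hPdisj h1).1 z hz hzb)
      · obtain ⟨ℓ, hℓ, Z, h1, h2, h3⟩ := hR Y hYP hYc x hx
        refine ⟨ℓ, hℓ, Z, h1, fun v hv => ?_, by rw [hYc]; exact h3⟩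
        have h4 := h2 v hv
        have h5 : ((D₀ + 1 : ℕ) : ℝ) ≤ 1 / (b : ℝ) * N / 4 := by
          have h6 : ((4 * b * (D₀ + 1) : ℕ) : ℝ) ≤ N := by exact_mod_cast hN1
          push_cast at h6 ⊢
          rw [one_div_mul_eq_div, div_div, le_div_iff₀ (by positivity)]
          linarith
        exact_mod_cast h5.trans h4)
    L r {D.root} (fun _ => x₀) D.root (by omega) (IsPartialEmb.singleton_root x₀) (by simp)
    (by simp [ParentTree.pdesc]) hx₀ (fun v hv _ => Finset.mem_singleton.1 hv)
    ((Finset.card_le_univ _).trans hdτ)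
  rw [← D.univ_eq] at hφ
  exact ⟨φ, hφ⟩

/-! ### Choice of the functions and conclusion -/

lemma ParentTree.card_children_le_maxDegree {W : Type*} [Fintype W] {T : SimpleGraph W}
    [DecidableRel T.Adj] {D : ParentTree W} (h : ∀ v, v ≠ D.root → T.Adj (D.par v) v) (c : W) :
    (D.children c).card ≤ T.maxDegree := by
  refine le_trans ?_ (T.degree_le_maxDegree c)
  rw [← card_neighborFinset_eq_degree]
  refine Finset.card_le_card fun v hv => ?_
  obtain ⟨h1, h2⟩ := mem_children.1 hv
  rw [mem_neighborFinset, ← h2]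
  exact h v h1

lemma one_div_le_of_ceil_le {L : ℕ} {x : ℝ} (hx : 0 < x) (hL : 0 < L) (h : ⌈1 / x⌉₊ ≤ L) :
    1 / (L : ℝ) ≤ x := by
  have h1 : 1 / x ≤ L := (Nat.le_ceil _).trans (by exact_mod_cast h)
  have hL0 : (0 : ℝ) < L := by exact_mod_cast hL
  rw [div_le_iff₀ hx] at h1
  rw [div_le_iff₀ hL0]
  linarith

end

theorem mainTheorem6 :
    ∃ f g : ℝ → ℝ, (∀ x, 0 < x → 0 < f x) ∧ (∀ x, 0 < x → 0 < g x) ∧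
      ∀ (p q ε : ℝ) (Δ L d : ℕ), 0 < p → 0 < q → 0 < ε → 0 < Δ → 0 < L →
        1 / (L : ℝ) ≤ f p → 1 / (L : ℝ) ≤ f q → 1 / (L : ℝ) ≤ f ε →
        1 / (L : ℝ) ≤ f (1 / (Δ : ℝ)) → 1 / (d : ℝ) ≤ g (1 / (L : ℝ)) →
        ∀ (W : Type*) [Fintype W] (T : SimpleGraph W) [DecidableRel T.Adj],
          T.IsTree → Fintype.card W = d → T.maxDegree ≤ Δ →
          ∀ (V : Type*) [Fintype V] (G : SimpleGraph V),
            G.IsCutDenseWithRegularSubgraph p q ((2 + ε) * (d : ℝ)) ∨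
              G.IsAryTreeOfCutDense q L (16 * (d : ℝ) / (q * (L : ℝ))) →
            T.IsContained G := by
  have hreg := fun (L : ℕ) (hL : 1 ≤ L) =>
    SimpleGraph.IsCutDenseWithRegularSubgraph.exists_emb hL
  have htree := fun (b : ℕ) (hb : 1 ≤ b) => SimpleGraph.IsAryTreeOfCutDense.exists_emb hb
  choose! d₁ hd₁ using hreg
  choose! L₀ hL₀ using htree
  choose! d₂ hd₂ using hL₀
  -- The function `g` sees only `L`, whereas `d₂` also depends on `b`; as `b ≤ L`, a supremum over
  -- this finite range suffices.
  refine ⟨fun x => 1 / ((max (L₀ ⌈1 / x⌉₊) ⌈1 / x⌉₊ + 1 : ℕ) : ℝ),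
    fun x => 1 / ((max (d₁ ⌈1 / x⌉₊) ((Finset.range (⌈1 / x⌉₊ + 1)).sup fun b => d₂ b ⌈1 / x⌉₊) + 1 :
      ℕ) : ℝ), fun x _ => by positivity, fun x _ => by positivity, ?_⟩
  intro p q ε Δ L d hp hq hε hΔ hL hfp hfq hfε hfΔ hg W _ T _ hT hW hTΔ V _ G hG
  have hL0 : (0 : ℝ) < L := by exact_mod_cast hL
  have hΔ0 : (0 : ℝ) < Δ := by exact_mod_cast hΔ
  have hinv : ∀ a c : ℕ, 0 < a → 1 / (a : ℝ) ≤ 1 / ((c + 1 : ℕ) : ℝ) → c ≤ a := by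
    intro a c ha h
    have ha0 : (0 : ℝ) < a := by exact_mod_cast ha
    rw [one_div_le_one_div ha0 (by positivity)] at h
    have : c + 1 ≤ a := by exact_mod_cast h
    omega
  have hWne : Nonempty W := hT.1.nonempty
  have hd : 0 < d := by rw [← hW]; exact Fintype.card_pos
  have hfp' := hinv _ _ hL hfp
  have hfq' := hinv _ _ hL hfq
  have hfε' := hinv _ _ hL hfε
  have hfΔ' := hinv _ _ hL hfΔ
  have hg' := hinv _ _ hd hg
  rw [one_div_one_div, Nat.ceil_natCast] at hfΔ' hg'
  obtain ⟨D, -, -, hD, hD'⟩ := hT.exists_parentTree (Classical.arbitrary W)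
  have hch : ∀ v, (D.children v).card ≤ Δ := fun v =>
    (ParentTree.card_children_le_maxDegree hD v).trans hTΔ
  subst hW
  rcases hG with hG | hG
  · obtain ⟨φ, hφ⟩ := hd₁ L hL D (fun v => (hch v).trans ((le_max_right _ _).trans hfΔ'))
      ((le_max_left _ _).trans hg') G p q ε
      (one_div_le_of_ceil_le hp hL ((le_max_right _ _).trans hfp'))
      (one_div_le_of_ceil_le hq hL ((le_max_right _ _).trans hfq'))
      (one_div_le_of_ceil_le hε hL ((le_max_right _ _).trans hfε')) hG
    exact hφ.isContained hD'
  -- Here `b` is the larger of `⌈1 / q⌉₊` and `Δ`. Being one of the two, it gets `L₀ b ≤ L` from the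
  -- condition on `f q` or on `f (1 / Δ)`, without monotonicity of `L₀`.
  · obtain ⟨b, hb1, hbL, hbL₀, hbq, hbΔ⟩ : ∃ b : ℕ, 1 ≤ b ∧ b ≤ L ∧ L₀ b ≤ L ∧ 1 / (b : ℝ) ≤ q ∧
        Δ ≤ b := by
      rcases le_total ⌈1 / q⌉₊ Δ with h | h
      · exact ⟨Δ, hΔ, (le_max_right _ _).trans hfΔ', (le_max_left _ _).trans hfΔ',
          one_div_le_of_ceil_le hq hΔ h, le_rfl⟩
      · have h0 : 0 < ⌈1 / q⌉₊ := Nat.ceil_pos.2 (by positivity)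
        exact ⟨⌈1 / q⌉₊, h0, (le_max_right _ _).trans hfq', (le_max_left _ _).trans hfq',
          one_div_le_of_ceil_le hq h0 le_rfl, h⟩
    have hd₂L : d₂ b L ≤ Fintype.card W := by
      refine le_trans ?_ ((le_max_right _ _).trans hg')
      exact Finset.le_sup (f := fun b => d₂ b L) (Finset.mem_range.2 (by omega))
    obtain ⟨φ, hφ⟩ := hd₂ b hb1 L hbL₀ D (fun v => (hch v).trans hbΔ) hd₂L G q hbq hG
    exact hφ.isContained hD'
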